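/- Let $D\in\mathbb N$, $\theta\in[0,1]$ and $\tau>0$. A finite sub-array $X$ of $\mathbb N^D$ is a product of $D$ nonempty finite intervals of consecutive indices, of lengths $N_X^{(1)},\dots,N_X^{(D)}\ge 1$; put $S_X=\prod_d N_X^{(d)}$, and write $X\preccurlyeq Y$ if $X$ is contained in $Y$. A patch in $X$ is a product of $D$ nonempty intervals of consecutive indices contained in the sides of $X$. A partition of $X$ is a finite sequence $(m_k,\Box_k)_{k=1}^K$, $K\ge 0$, of patches $\Box_k$ in $X$ with costs $m_k\ge 0$; its time points are $t_k=m_1+\dots+m_k$. Let $\Omega_X$ be the set of partitions of $X$ with its natural $\sigma$-algebra $\mathcal B_X$ (the disjoint union over $K$ of the product spaces). For $X\preccurlyeq Y$ the restriction $\pi_{Y,X}:\Omega_Y\to\Omega_X$ replaces each patch $\Box_k$ by $\Box_k\cap X$, deletes the patches that become empty, and keeps the time points of the remaining ones (their new costs are the successive differences of these time points). $\mathrm{SPP}(X,\tau)$ (with parameter $\theta$) is the law $P^X$ on $\Omega_X$ of the following random partition. Draw $\hat K\sim\mathrm{Poisson}(\tau S_X)$ and, given $\hat K$, draw $\hat K$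 i.i.d. candidate patches, each with independent dimensions $d=1,\dots,D$: the initial position $s$ is uniform on $\{1,\dots,N_X^{(d)}\}$; the side-length $l$ is positive with probability $1$ if $s=1$ and with probability $1-\theta$ if $s>1$, and is $0$ otherwise; given that it is positive, with $L_*=N_X^{(d)}-s+1$, it equals $l$ with probability $\theta^{l-1}(1-\theta)$ for $1\le l<L_*$ and equals $L_*$ with probability $\theta^{L_*-1}$ (where $0^0=1$). Remove the candidates having some side-length $0$, leaving patches $\Box_1,\dots,\Box_K$; draw $K$ i.i.d. uniform time points in $(0,\tau]$, sort them as $t_1<\dots<t_K$, and let $m_k=t_k-t_{k-1}$ with $t_0=0$. Theorem. For every finite sub-array $X$ of $\mathbb N^D$, $P^X$ is a probability measure on $(\Omega_X,\mathcal B_X)$. The restriction maps are measurable and form a projective system: $\pi_{X,X}=\mathrm{id}$, and $\pi_{X,W}\circ\pi_{Y,X}=\pi_{Y,W}$ for $W\preccurlyeq X\preccurlyeq Y$. If $X\preccurlyeq Y$, then the restriction to $X$ of $\mathrm{SPP}(Y,\tau)$ is $\mathrm{SPP}(X,\tau)$, that is, $P^Y(\pi_{Y,X}^{-1}B)=P^X(B)$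 for all $B\in\mathcal B_X$. Consequently, let $\Omega_{\mathbb N^D}$ be the projective limit, i.e. the set of families $(\omega_X)_X$, indexed by all finite sub-arrays, with $\omega_X\in\Omega_X$ and $\pi_{Y,X}(\omega_Y)=\omega_X$ whenever $X\preccurlyeq Y$, with the $\sigma$-algebra generated by the coordinate maps $\omega\mapsto\omega_X$. Then there is a unique measure $P^{\mathbb N^D}$ on $\Omega_{\mathbb N^D}$ whose image under each coordinate map $\omega\mapsto\omega_X$ is $P^X$, and it is a probability measure. -/

import Mathlib

open MeasureTheory ProbabilityTheory
open scoped NNReal ENNReal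

noncomputable section

namespace SPP

/-! ### Finite sub-arrays of the infinite array -/

/-- A finite sub-array of the infinite `D`-dimensional array `ℕ^D`: a product over the dimensions
`d` of the nonempty intervals of consecutive indices `lo d, …, lo d + len d - 1`. -/
structure SubArray (D : ℕ) where
  lo : Fin D → ℕ
  len : Fin D → ℕ
  len_pos : ∀ d, 0 < len d

/-- The index interval of the sub-array `X` in dimension `d`. -/
def SubArray.side {D : ℕ} (X : SubArray D) (d : Fin D) : Finset ℕ :=
  Finset.Ico (X.lo d) (X.lo d + X.len d)

/-- The volume (number of cells) of a sub-array, the product of its side-lengths. -/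
def SubArray.volume {D : ℕ} (X : SubArray D) : ℕ := ∏ d, X.len d

/-- `X ≤ Y`: the array `X` is a sub-array of `Y`. -/
instance {D : ℕ} : LE (SubArray D) := ⟨fun X Y => ∀ d, X.side d ⊆ Y.side d⟩

/-! ### Patches -/

/-- A nonempty segment of consecutive natural numbers. -/
def IsSegment (u : Finset ℕ) : Prop := ∃ s l : ℕ, 0 < l ∧ u = Finset.Ico s (s + l)

/-- A nonempty rectangular patch in `X`: the outer product of `D` position indicator vectors, each
of which has as its `1`-entries a nonempty segment of consecutive positions of that side of `X`.
An indicator vector is recorded by the finite set `u d` of the positions of its `1`-entries, as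
indices of the infinite array. -/
@[ext]
structure Patch {D : ℕ} (X : SubArray D) where
  u : Fin D → Finset ℕ
  isSegment : ∀ d, IsSegment (u d)
  subset : ∀ d, u d ⊆ X.side d

/-- There are only finitely many patches in `X`; all sets of patches are measurable. -/
instance {D : ℕ} (X : SubArray D) : MeasurableSpace (Patch X) := ⊤

theorem IsSegment.inter_side {D : ℕ} {X : SubArray D} {d : Fin D} {u : Finset ℕ}
    (hu : IsSegment u) (hne : (u ∩ X.side d).Nonempty) : IsSegment (u ∩ X.side d) := by
  obtain ⟨s, l, -, rfl⟩ := hu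
  unfold SubArray.side at *
  rw [Finset.Ico_inter_Ico] at *
  obtain ⟨x, hx⟩ := hne
  rw [Finset.mem_Ico] at hx
  refine ⟨max s (X.lo d), min (s + l) (X.lo d + X.len d) - max s (X.lo d), by omega, ?_⟩
  congr 1
  omega

/-- Restriction of a patch in `Y` to `X`: the entries in `X` are kept unchanged and the others are
removed. The result is `none` if nothing is left, that is, if the patch does not meet `X`. -/
def Patch.restrict {D : ℕ} {Y : SubArray D} (X : SubArray D) (p : Patch Y) : Option (Patch X) :=
  if h : ∀ d, (p.u d ∩ X.side d).Nonempty then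
    some
      { u := fun d => p.u d ∩ X.side d
        isSegment := fun d => (p.isSegment d).inter_side (h d)
        subset := fun _ => Finset.inter_subset_right }
  else none

/-! ### Partitions and their restriction -/

/-- A partition of `X`: a finite sequence `(m₁, □₁), …, (m_K, □_K)` of nonempty patches `□ₖ` in `X`
with costs `mₖ`. The patch `□ₖ` is generated at the time point `tₖ = m₁ + ⋯ + mₖ`. -/
def Partition {D : ℕ} (X : SubArray D) : Type := List (ℝ≥0 × Patch X)

/-- The `σ`-algebra on partitions: that of the disjoint union over `K` of the product spaces of
sequences of length `K` of pairs (cost, patch). -/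
instance {D : ℕ} (X : SubArray D) : MeasurableSpace (Partition X) :=
  MeasurableSpace.comap (List.equivSigmaTuple (α := ℝ≥0 × Patch X)) inferInstance

/-- Auxiliary recursion for `Partition.restrict`. The accumulator `c` is the time elapsed since the
last patch that survived the restriction. -/
def restrictAux {D : ℕ} {Y : SubArray D} (X : SubArray D) :
    ℝ≥0 → List (ℝ≥0 × Patch Y) → List (ℝ≥0 × Patch X)
  | _, [] => []
  | c, (m, p) :: r =>
    match p.restrict X with
    | some q => (c + m, q) :: restrictAux X 0 r
    | none => restrictAux X (c + m) r

/-- The projection `π_{Y,X}`: every patch is restricted to `X`, the patches that become empty are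
removed, and each surviving patch keeps its time point `tₖ` (so the cost of a surviving patch is the
difference between its time point and that of the preceding surviving patch). -/
def Partition.restrict {D : ℕ} {X Y : SubArray D} (_h : X ≤ Y) (ω : Partition Y) : Partition X :=
  restrictAux X 0 ω

/-! ### The generative process -/

/-- The law of a positive side-length with largest possible value `L`. -/
def lengthLaw (θ : unitInterval) (L : ℕ) : Measure ℕ :=
  (∑ l ∈ Finset.Ico 1 L, ENNReal.ofReal ((θ : ℝ) ^ (l - 1) * (1 - θ)) • Measure.dirac l)
    + ENNReal.ofReal ((θ : ℝ) ^ (L - 1)) • Measure.dirac L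

/-- The law of (initial position, side-length) of a candidate patch in one dimension with `N`
positions: the initial position `s` is uniform on `{1, …, N}`; the side-length is incremented
from `0` to `1` with probability `1` if `s = 1` and `1 - θ` otherwise; if it has been incremented,
the side-length is drawn from `lengthLaw` with largest value `N - s + 1`, otherwise it is `0`. -/
def sideLaw (θ : unitInterval) (N : ℕ) : Measure (ℕ × ℕ) :=
  (uniformOn (Set.Icc 1 N)).bind fun s =>
    (bernoulliMeasure true false (if s = 1 then 1 else unitInterval.symm θ)).bind fun b =>
      if b then (lengthLaw θ (N - s + 1)).map fun l => (s, l) else Measure.dirac (s, 0)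

/-- The law of a candidate patch in `X`: independent dimensions. A candidate is recorded by its
initial position (counted from `1` within `X`) and side-length in each dimension. -/
def candidateLaw {D : ℕ} (θ : unitInterval) (X : SubArray D) : Measure (Fin D → ℕ × ℕ) :=
  Measure.pi fun d => sideLaw θ (X.len d)

/-- The set of indices (in the infinite array) covered in dimension `d` of `X` by a segment of
length `c.2` that starts at the `c.1`-th position of that side. -/
def SubArray.cells {D : ℕ} (X : SubArray D) (d : Fin D) (c : ℕ × ℕ) : Finset ℕ :=
  Finset.Ico (X.lo d + (c.1 - 1)) (X.lo d + (c.1 - 1) + c.2)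

/-- The patch given by a candidate, or `none` if the candidate is empty (some side-length is `0`).
The inclusion in the sides of `X` holds for all candidates that are drawn from `candidateLaw`. -/
def ofCandidate {D : ℕ} (X : SubArray D) (c : Fin D → ℕ × ℕ) : Option (Patch X) :=
  if h : ∀ d, 0 < (c d).2 ∧ X.cells d (c d) ⊆ X.side d then
    some
      { u := fun d => X.cells d (c d)
        isSegment := fun d => ⟨_, _, (h d).1, rfl⟩
        subset := fun d => (h d).2 }
  else none

/-- The time points `t` in increasing order. -/
def sortedTime {K : ℕ} (t : Fin K → ℝ) : Fin K → ℝ := t ∘ Tuple.sort t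

/-- The costs `mₖ = tₖ - tₖ₋₁` (with `t₀ = 0`), where `t₁ ≤ ⋯ ≤ t_K` are the sorted time points.
In Lean the index `k` runs from `0`. -/
def cost {K : ℕ} (t : Fin K → ℝ) (k : Fin K) : ℝ≥0 :=
  Real.toNNReal (sortedTime t k -
    if (k : ℕ) = 0 then 0 else sortedTime t ⟨(k : ℕ) - 1, (Nat.sub_le _ _).trans_lt k.isLt⟩)

/-- The partition with the nonempty patches `ps` and the costs determined by the time points `t`. -/
def assemble {D : ℕ} {X : SubArray D} (ps : List (Patch X)) (t : Fin ps.length → ℝ) :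
    Partition X :=
  List.ofFn fun k => (cost t k, ps.get k)

/-- The law `SPP(X, τ)` with parameter `θ`: draw the number of candidates from the Poisson
distribution with mean `τ · S_X`; draw that many i.i.d. candidates; remove the empty ones; draw
as many i.i.d. uniform time points in `(0, τ]` as there are nonempty patches; sort them, and let the
costs be their successive differences. -/
def law {D : ℕ} (θ : unitInterval) (τ : ℝ≥0) (X : SubArray D) : Measure (Partition X) :=
  (poissonMeasure (τ * X.volume)).bind fun n =>
    (Measure.pi fun _ : Fin n => candidateLaw θ X).bind fun c =>
      (Measure.pi fun _ : Fin ((List.ofFn c).filterMap (ofCandidate X)).length =>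
          cond (volume : Measure ℝ) (Set.Ioc 0 (τ : ℝ))).map
        (assemble ((List.ofFn c).filterMap (ofCandidate X)))

/-! ### The projective limit -/

/-- The projective limit of the spaces of partitions: the families of partitions of all finite
sub-arrays that are compatible under restriction. Its `σ`-algebra is the one generated by the
coordinate maps to the partitions of `X`, for `X` a finite sub-array. -/
def LimitPartition (D : ℕ) : Type :=
  {ω : (X : SubArray D) → Partition X //
    ∀ (X Y : SubArray D) (h : X ≤ Y), (ω Y).restrict h = ω X}

instance {D : ℕ} : MeasurableSpace (LimitPartition D) :=
  inferInstanceAs (MeasurableSpace (Subtype _))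

/-- The restriction of a partition of the infinite array to the finite sub-array `X`. -/
def LimitPartition.restrict {D : ℕ} (X : SubArray D) (ω : LimitPartition D) : Partition X :=
  ω.1 X

end SPP

end

noncomputable section

namespace SPP

/-! ### The measurable space of lists -/

section Lists

variable {α β γ : Type*} [MeasurableSpace α] [MeasurableSpace β] [MeasurableSpace γ]

/-! `SPP.law θ τ X` is a marked Poisson process in disguise. A Poisson number of i.i.d. candidates
has law `e^{-r} ∑ rⁿ κⁿ / n!`, a multiple of the exponential series `listExp` of the intensity `r •
κ`. By thinning (`map_filterMap_listExp`), deleting points multiplies such a series by a constant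
and replaces the intensity by that of the survivors. By exchangeability (`lintegral_costs_eq`),
handing out i.i.d. patches to the sorted times gives the same law as attaching an independent time
to each patch and sorting the pairs. So the law is a multiple of `listExp` of (uniform time) ×
(patch intensity), sorted and differenced (`exists_law_eq_smul`).

Restriction keeps time points, so it commutes with sorting and differencing and acts as a further
thinning. Consistency is thereby reduced to intensities: the patches of `Y` that restrict to a given
patch of `X` must have the intensity of that patch in `SPP(X, τ)`. As the mean number of candidates
is proportional to the volume, this factors over the dimensions, and the length `N` cancels the
uniform weight `1/N` (`mul_sideLaw_inter`). A segment cut at the left edge of `X` may have started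
anywhere to the left; the geometric tails, weighted by `1 - θ` inside `Y` and by `1` at its border,
add up to exactly `1` (`sum_ite_mul_pow`), the weight of a start at the border of `X`. On the right
the truncated geometric law plays the same role. The constants need no computation: both sides are
probability measures (`map_restrict_law`).

For the limit, cubes are cofinal and the partition spaces are standard Borel, so conditional
distributions and the Ionescu-Tulcea construction give a measure on compatible sequences, which is
pushed to the projective limit. Uniqueness holds because cylinder sets form a π-system. -/

instance : MeasurableSpace (List α) :=
  MeasurableSpace.comap (List.equivSigmaTuple (α := α)) inferInstance

/-- Lists and tuples of variable length are the same measurable space. -/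
def listMeasurableEquiv : List α ≃ᵐ Σ n, Fin n → α where
  toEquiv := List.equivSigmaTuple
  measurable_toFun := comap_measurable _
  measurable_invFun := by
    rintro s ⟨t, ht, rfl⟩
    rw [← Set.preimage_comp]
    convert ht
    ext x
    exact iff_of_eq (congrArg (· ∈ t) (List.equivSigmaTuple.apply_symm_apply x))

theorem measurable_sigma_iff {ι : Type*} {A : ι → Type*} [∀ i, MeasurableSpace (A i)]
    {f : (Σ i, A i) → β} : Measurable f ↔ ∀ i, Measurable fun x : A i => f ⟨i, x⟩ := by
  have hS : ∀ s : Set (Σ i, A i), MeasurableSet s ↔ ∀ i, MeasurableSet (Sigma.mk i ⁻¹' s) := by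
    intro s
    exact MeasurableSpace.measurableSet_iInf
  constructor
  · intro h i s hs
    exact (hS _).1 (h hs) i
  · intro h s hs
    exact (hS _).2 fun i => h i hs

theorem measurableEmbedding_sigmaMk {ι : Type*} {A : ι → Type*} [∀ i, MeasurableSpace (A i)]
    (i : ι) : MeasurableEmbedding (Sigma.mk i : A i → Σ i, A i) where
  injective := sigma_mk_injective
  measurable := measurable_sigma_iff.1 measurable_id i
  measurableSet_image' := by
    intro s hs
    refine MeasurableSpace.measurableSet_iInf.2 fun j => ?_
    change MeasurableSet (Sigma.mk j ⁻¹' _)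
    by_cases h : j = i
    · subst h
      rwa [Set.preimage_image_eq _ sigma_mk_injective]
    · rw [Set.preimage_image_sigmaMk_of_ne h]
      exact MeasurableSet.empty

theorem measurableEmbedding_ofFn (n : ℕ) :
    MeasurableEmbedding (List.ofFn : (Fin n → α) → List α) :=
  listMeasurableEquiv.symm.measurableEmbedding.comp (measurableEmbedding_sigmaMk n)

@[fun_prop]
theorem measurable_ofFn (n : ℕ) : Measurable (List.ofFn : (Fin n → α) → List α) :=
  (measurableEmbedding_ofFn n).measurable

theorem measurable_list_iff {f : List α → β} :
    Measurable f ↔ ∀ n, Measurable fun v : Fin n → α => f (List.ofFn v) := by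
  rw [← MeasurableEquiv.measurable_comp_iff listMeasurableEquiv.symm, measurable_sigma_iff]
  rfl

/-- The product is a countable union of measurably embedded pieces `γ × αⁿ`. -/
theorem measurable_prod_list {f : γ × List α → β}
    (h : ∀ n, Measurable fun x : γ × (Fin n → α) => f (x.1, List.ofFn x.2)) : Measurable f := by
  intro s hs
  have : f ⁻¹' s = ⋃ n, Prod.map id List.ofFn ''
      ((fun x : γ × (Fin n → α) => f (x.1, List.ofFn x.2)) ⁻¹' s) := by
    ext ⟨c, l⟩
    simp only [Set.mem_preimage, Set.mem_iUnion, Set.mem_image, Prod.exists, Prod.map_apply, id,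
      Prod.mk.injEq]
    constructor
    · intro hl
      exact ⟨l.length, c, l.get, by simpa using hl, rfl, by simp⟩
    · rintro ⟨n, c, v, hv, rfl, rfl⟩
      exact hv
  rw [this]
  exact MeasurableSet.iUnion fun n =>
    (MeasurableEmbedding.id.prodMap (measurableEmbedding_ofFn n)).measurableSet_image.2 (h n hs)

/-- Induction principle for recursive functions on lists. The parameter in `γ` is an accumulator,
which may change in the recursive call. -/
theorem measurable_prod_list_of_cons {f : γ × List α → β} (h0 : Measurable fun c => f (c, []))
    (hs : ∀ n, (Measurable fun x : γ × (Fin n → α) => f (x.1, List.ofFn x.2)) →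
      Measurable fun x : γ × α × (Fin n → α) => f (x.1, x.2.1 :: List.ofFn x.2.2)) :
    Measurable f := by
  refine measurable_prod_list fun n => ?_
  induction n with
  | zero => simpa [Function.comp_def] using h0.comp measurable_fst
  | succ n ih =>
    have := (hs n ih).comp (f := fun x : γ × (Fin (n + 1) → α) => (x.1, x.2 0, fun i => x.2 i.succ))
      (by fun_prop)
    simpa [Function.comp_def, List.ofFn_succ] using this

@[fun_prop]
theorem measurable_cons : Measurable fun x : α × List α => x.1 :: x.2 := by
  refine measurable_prod_list fun n => ?_
  have : Measurable fun x : α × (Fin n → α) => List.ofFn (Fin.cons x.1 x.2 : Fin (n + 1) → α) := by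
    refine (measurable_ofFn _).comp (measurable_pi_iff.2 fun i => ?_)
    refine Fin.cases ?_ (fun i => ?_) i <;> simp <;> fun_prop
  simpa [List.ofFn_cons] using this

@[fun_prop]
theorem _root_.Measurable.listCons {f : γ → α} {g : γ → List α} (hf : Measurable f) (hg : Measurable g) :
    Measurable fun x => f x :: g x :=
  measurable_cons.comp (hf.prodMk hg)

theorem measurable_list_of_cons {f : List α → β}
    (hs : ∀ n, (Measurable fun x : Fin n → α => f (List.ofFn x)) →
      Measurable fun x : α × (Fin n → α) => f (x.1 :: List.ofFn x.2)) :
    Measurable f := by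
  have : Measurable fun x : Unit × List α => f x.2 := by
    refine measurable_prod_list_of_cons (measurable_const (a := f [])) fun n h => ?_
    have h' := h.comp (f := fun x : Fin n → α => ((), x)) (by fun_prop)
    exact (hs n h').comp (f := fun x : Unit × α × (Fin n → α) => x.2) (by fun_prop)
  exact this.comp (f := fun x => ((), x)) (by fun_prop)

/-- The total function `d` extends `g` beyond the points that are kept, so that no σ-algebra on
`Option β` is needed. -/
theorem measurable_filterMap {g : α → Option β} (hn : MeasurableSet {x | g x = none})
    {d : α → β} (hd : Measurable d) (hg : ∀ x y, g x = some y → d x = y) :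
    Measurable (List.filterMap g) := by
  refine measurable_list_of_cons fun n h => ?_
  have : (fun x : α × (Fin n → α) => List.filterMap g (x.1 :: List.ofFn x.2)) =
      fun x => haveI := Classical.dec (x.1 ∈ {x | g x = none}); if x.1 ∈ {x | g x = none} then
        List.filterMap g (List.ofFn x.2) else d x.1 :: List.filterMap g (List.ofFn x.2) := by
    funext x
    rcases hx : g x.1 with _ | y
    · simp [hx]
    · simp [hx, hg _ _ hx]
  rw [this]
  have h' : Measurable fun x : α × (Fin n → α) => List.filterMap g (List.ofFn x.2) :=
    h.comp measurable_snd
  exact Measurable.ite (measurable_fst hn) h' ((hd.comp measurable_fst).listCons h')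

theorem measurable_orderedInsert (r : α → α → Prop) [DecidableRel r]
    (hr : MeasurableSet {x : α × α | r x.1 x.2}) :
    Measurable fun x : α × List α => List.orderedInsert r x.1 x.2 := by
  refine measurable_prod_list_of_cons ?_ fun n h => ?_
  · simp only [List.orderedInsert_nil]
    fun_prop
  · simp only [List.orderedInsert_cons]
    refine Measurable.ite ?_ (by fun_prop) ?_
    · exact hr.preimage (f := fun x : α × α × (Fin n → α) => (x.1, x.2.1)) (by fun_prop)
    · refine Measurable.listCons (by fun_prop) ?_
      exact h.comp (f := fun x : α × α × (Fin n → α) => (x.1, x.2.2)) (by fun_prop)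

theorem measurable_insertionSort (r : α → α → Prop) [DecidableRel r]
    (hr : MeasurableSet {x : α × α | r x.1 x.2}) :
    Measurable fun l : List α => l.insertionSort r := by
  refine measurable_list_of_cons fun n h => ?_
  simp only [List.insertionSort_cons]
  exact (measurable_orderedInsert r hr).comp
    (measurable_fst.prodMk (h.comp measurable_snd))

end Lists

/-! ### Sorting marked time points and taking their successive differences -/

section Marked

variable {M N : Type*}

/-- Comparison of marked points by their times. -/
def timeLE (x y : ℝ × M) : Prop := x.1 ≤ y.1

instance : DecidableRel (timeLE (M := M)) := fun x y => inferInstanceAs (Decidable (x.1 ≤ y.1))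

instance : IsTrans (ℝ × M) timeLE := ⟨fun _ _ _ h h' => le_trans (α := ℝ) h h'⟩

instance : Std.Total (timeLE (M := M)) := ⟨fun x y => le_total x.1 y.1⟩

/-- The marked points sorted by their times. -/
def timeSort (l : List (ℝ × M)) : List (ℝ × M) := l.insertionSort timeLE

theorem pairwise_timeSort (l : List (ℝ × M)) : (timeSort l).Pairwise timeLE :=
  List.pairwise_insertionSort _ l

/-- The successive differences of the times, starting from the time `c`. -/
def diffs : ℝ → List (ℝ × M) → List (ℝ≥0 × M)
  | _, [] => []
  | c, x :: l => (Real.toNNReal (x.1 - c), x.2) :: diffs x.1 l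

/-- If `a` goes in front of a sorted list, all later survivors have times at least that of `a`, so
its image goes in front as well, even when the element it was compared with is removed. -/
theorem filterMap_orderedInsert {g : ℝ × M → Option (ℝ × N)}
    (hg : ∀ x y, g x = some y → y.1 = x.1) (a : ℝ × M) (l : List (ℝ × M))
    (hl : l.Pairwise timeLE) :
    (l.orderedInsert timeLE a).filterMap g =
      match g a with
      | none => l.filterMap g
      | some b => (l.filterMap g).orderedInsert timeLE b := by
  induction l with
  | nil => cases h : g a <;> simp [h]
  | cons x l ih =>
    rw [List.pairwise_cons] at hl
    rw [List.orderedInsert_cons]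
    split_ifs with hax
    · rcases ha : g a with _ | b
      · simp [ha]
      · have hall : ∀ y ∈ (x :: l).filterMap g, timeLE b y := by
          intro y hy
          obtain ⟨z, hz, hzy⟩ := List.mem_filterMap.1 hy
          have h1 : y.1 = z.1 := hg _ _ hzy
          have h2 : b.1 = a.1 := hg _ _ ha
          unfold timeLE at *
          rw [h1, h2]
          rcases List.mem_cons.1 hz with rfl | hz
          · exact hax
          · exact hax.trans (hl.1 z hz)
        rw [List.filterMap_cons_some ha]
        generalize (x :: l).filterMap g = m at hall
        cases m with
        | nil => rfl
        | cons y m => exact (List.orderedInsert_cons_of_le _ _ (hall y (by simp))).symm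
    · rcases hx : g x with _ | y
      · rw [List.filterMap_cons_none hx, ih hl.2, List.filterMap_cons_none hx]
      · rw [List.filterMap_cons_some hx, ih hl.2, List.filterMap_cons_some hx]
        rcases ha : g a with _ | b
        · rfl
        · have : ¬ timeLE b y := by
            unfold timeLE at *
            rwa [hg _ _ ha, hg _ _ hx]
          simp [List.orderedInsert_cons, this]

theorem filterMap_timeSort {g : ℝ × M → Option (ℝ × N)}
    (hg : ∀ x y, g x = some y → y.1 = x.1) (l : List (ℝ × M)) :
    (timeSort l).filterMap g = timeSort (l.filterMap g) := by
  induction l with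
  | nil => rfl
  | cons x l ih =>
    have h := filterMap_orderedInsert hg x _ (pairwise_timeSort l)
    rw [ih] at h
    unfold timeSort at *
    rw [List.insertionSort_cons, h]
    rcases hx : g x with _ | y
    · simp [hx]
    · simp [hx]

variable [MeasurableSpace M]

theorem measurable_timeSort : Measurable (timeSort : List (ℝ × M) → List (ℝ × M)) :=
  measurable_insertionSort _ (measurableSet_le (by fun_prop) (by fun_prop))

theorem measurable_diffs : Measurable fun x : ℝ × List (ℝ × M) => diffs x.1 x.2 := by
  refine measurable_prod_list_of_cons ?_ fun n h => ?_
  · simp only [diffs]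
    fun_prop
  · simp only [diffs]
    refine Measurable.listCons (by fun_prop) ?_
    exact h.comp (f := fun x : ℝ × (ℝ × M) × (Fin n → ℝ × M) => (x.2.1.1, x.2.2)) (by fun_prop)

end Marked

/-! ### The projective system -/

section Projective

variable {D : ℕ}

instance (X : SubArray D) : Finite (Patch X) := by
  refine Finite.of_injective
    (β := ∀ d, (X.side d).powerset) (fun p d => ⟨p.u d, Finset.mem_powerset.2 (p.subset d)⟩) ?_
  intro p q h
  ext1
  funext d
  exact congrArg Subtype.val (congrFun h d)

theorem IsSegment.nonempty {u : Finset ℕ} (h : IsSegment u) : u.Nonempty := by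
  obtain ⟨s, l, hl, rfl⟩ := h
  exact ⟨s, by simp [hl]⟩

theorem Patch.restrict_eq_some_iff {X Y : SubArray D} {p : Patch Y} {q : Patch X} :
    p.restrict X = some q ↔ ∀ d, p.u d ∩ X.side d = q.u d := by
  unfold Patch.restrict
  constructor
  · intro h d
    split_ifs at h with h'
    rw [Option.some.injEq] at h
    rw [← h]
  · intro h
    rw [dif_pos fun d => (h d).symm ▸ (q.isSegment d).nonempty]
    congr 1
    ext1
    funext d
    exact h d

theorem Patch.restrict_self {X : SubArray D} (p : Patch X) : p.restrict X = some p :=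
  Patch.restrict_eq_some_iff.2 fun d => Finset.inter_eq_left.2 (p.subset d)

theorem Patch.restrict_restrict {W X Y : SubArray D} (h : W ≤ X) (p : Patch Y) :
    (p.restrict X).bind (Patch.restrict W) = p.restrict W := by
  ext q
  have hW : ∀ (u : Finset ℕ) d, u ∩ X.side d ∩ W.side d = u ∩ W.side d := fun u d => by
    rw [Finset.inter_assoc, Finset.inter_eq_right.2 (h d)]
  simp only [Option.bind_eq_some_iff, Patch.restrict_eq_some_iff]
  constructor
  · rintro ⟨r, hr, hq⟩ d
    rw [← hq, ← hr, hW]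
  · intro hq
    have hne : ∀ d, (p.u d ∩ X.side d).Nonempty := fun d =>
      ((q.isSegment d).nonempty).mono (by
        rw [← hq]; exact Finset.inter_subset_inter_left (h d))
    refine ⟨⟨fun d => p.u d ∩ X.side d, fun d => (p.isSegment d).inter_side (hne d),
      fun _ => Finset.inter_subset_right⟩, fun d => rfl, fun d => ?_⟩
    simp only [hW, hq]

theorem restrictAux_self {X : SubArray D} (l : List (ℝ≥0 × Patch X)) :
    restrictAux X 0 l = l := by
  induction l with
  | nil => rfl
  | cons x l ih => simp [restrictAux, Patch.restrict_self, ih]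

/-- The time pending in the inner restriction is passed on to the outer one, so the accumulators
add. -/
theorem restrictAux_restrictAux {W X Y : SubArray D} (h : W ≤ X) (l : List (ℝ≥0 × Patch Y))
    (b c : ℝ≥0) : restrictAux W b (restrictAux X c l) = restrictAux W (b + c) l := by
  induction l generalizing b c with
  | nil => rfl
  | cons x l ih =>
    obtain ⟨m, p⟩ := x
    have hp := Patch.restrict_restrict h p
    rcases hX : p.restrict X with _ | q
    · rw [hX, Option.bind_none] at hp
      simp [restrictAux, hX, ← hp, ih, add_assoc]
    · rw [hX, Option.bind_some] at hp
      rcases hW : q.restrict W with _ | r <;> rw [hW] at hp <;>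
        simp [restrictAux, hX, ← hp, ih, add_assoc, hW]

theorem measurable_restrictAux (X Y : SubArray D) :
    Measurable fun x : ℝ≥0 × List (ℝ≥0 × Patch Y) => restrictAux X x.1 x.2 := by
  refine measurable_prod_list_of_cons ?_ fun n h => ?_
  · simp only [restrictAux]
    fun_prop
  -- Patches form a countable discrete space, so the patch can be fixed, which decides the branch of
  -- the recursion.
  · have h' : Measurable fun x : Patch Y × ℝ≥0 × ℝ≥0 × (Fin n → ℝ≥0 × Patch Y) =>
        restrictAux X x.2.1 ((x.2.2.1, x.1) :: List.ofFn x.2.2.2) := by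
      refine measurable_from_prod_countable_right fun p => ?_
      rcases hp : p.restrict X with _ | q
      · simp only [restrictAux, hp]
        exact h.comp (f := fun x : ℝ≥0 × ℝ≥0 × (Fin n → ℝ≥0 × Patch Y) => (x.1 + x.2.1, x.2.2))
          (by fun_prop)
      · simp only [restrictAux, hp]
        refine Measurable.listCons (by fun_prop) ?_
        exact h.comp (f := fun x : ℝ≥0 × ℝ≥0 × (Fin n → ℝ≥0 × Patch Y) => (0, x.2.2))
          (by fun_prop)
    exact h'.comp (f := fun x : ℝ≥0 × (ℝ≥0 × Patch Y) × (Fin n → ℝ≥0 × Patch Y) =>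
      (x.2.1.2, x.1, x.2.1.1, x.2.2)) (by fun_prop)

theorem measurable_restrict {X Y : SubArray D} (h : X ≤ Y) :
    Measurable (Partition.restrict h : Partition Y → Partition X) :=
  (measurable_restrictAux X Y).comp (f := fun l => ((0 : ℝ≥0), l)) (by fun_prop)

theorem Partition.restrict_self {X : SubArray D} (h : X ≤ X) (ω : Partition X) :
    ω.restrict h = ω :=
  restrictAux_self ω

theorem Partition.restrict_restrict {W X Y : SubArray D} (hWX : W ≤ X) (hXY : X ≤ Y)
    (hWY : W ≤ Y) (ω : Partition Y) : (ω.restrict hXY).restrict hWX = ω.restrict hWY :=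
  (restrictAux_restrictAux hWX ω 0 0).trans (by rw [add_zero]; rfl)

/-- The restriction of a marked point to `X`, which keeps its time. -/
def restrictPoint {Y : SubArray D} (X : SubArray D) (x : ℝ × Patch Y) : Option (ℝ × Patch X) :=
  (x.2.restrict X).map fun q => (x.1, q)

/-- A pending time `a` means that the last survivor occurred at time `c - a`. Sortedness and `hc`
ensure that `Real.toNNReal` truncates nothing. -/
theorem restrictAux_diffs {X Y : SubArray D} (l : List (ℝ × Patch Y)) (a : ℝ≥0) (c : ℝ)
    (hl : l.Pairwise timeLE) (hc : ∀ x ∈ l, c ≤ x.1) :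
    restrictAux X a (diffs c l) = diffs (c - a) (l.filterMap (restrictPoint X)) := by
  induction l generalizing a c with
  | nil => rfl
  | cons x l ih =>
    rw [List.pairwise_cons] at hl
    have hx : c ≤ x.1 := hc x (by simp)
    rcases hp : x.2.restrict X with _ | q
    · have : restrictPoint X x = none := by simp [restrictPoint, hp]
      simp only [diffs, restrictAux, hp, List.filterMap_cons_none this]
      rw [ih _ _ hl.2 hl.1]
      congr 1
      rw [NNReal.coe_add, Real.coe_toNNReal _ (sub_nonneg.2 hx)]
      ring
    · have : restrictPoint X x = some (x.1, q) := by simp [restrictPoint, hp]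
      simp only [diffs, restrictAux, hp, List.filterMap_cons_some this]
      rw [ih _ _ hl.2 hl.1]
      congr 2
      · rw [← NNReal.coe_inj, NNReal.coe_add, Real.coe_toNNReal _ (sub_nonneg.2 hx),
          Real.coe_toNNReal _ (by linarith [a.2, (NNReal.coe_nonneg a)])]
        ring
      · simp

theorem restrict_diffs_timeSort {X Y : SubArray D} (l : List (ℝ × Patch Y))
    (hl : ∀ x ∈ l, 0 < x.1) :
    restrictAux X 0 (diffs 0 (timeSort l)) =
      diffs 0 (timeSort (l.filterMap (restrictPoint X))) := by
  rw [restrictAux_diffs _ _ _ (pairwise_timeSort l)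
    (fun x hx => (hl x ((List.mem_insertionSort _).1 hx)).le), filterMap_timeSort]
  · simp
  · intro x y h
    rw [restrictPoint, Option.map_eq_some_iff] at h
    obtain ⟨q, -, rfl⟩ := h
    rfl

end Projective

/-! ### Lists of independent points and their exponential generating measure -/

section ListExp

open scoped Nat

variable {α β : Type*} [MeasurableSpace α] [MeasurableSpace β]

/-- The law of a list of `n` independent points with intensity `μ`. -/
def listPow (μ : Measure α) (n : ℕ) : Measure (List α) :=
  (Measure.pi fun _ : Fin n => μ).map List.ofFn

/-- The exponential series of the measures `listPow μ n`. -/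
def listExp (μ : Measure α) : Measure (List α) :=
  Measure.sum fun n => ((n ! : ℝ≥0∞)⁻¹) • listPow μ n

theorem lintegral_listPow (μ : Measure α) (n : ℕ) {F : List α → ℝ≥0∞} (hF : Measurable F) :
    ∫⁻ l, F l ∂listPow μ n = ∫⁻ v, F (List.ofFn v) ∂Measure.pi fun _ : Fin n => μ :=
  lintegral_map hF (measurable_ofFn n)

theorem lintegral_listExp (μ : Measure α) (F : List α → ℝ≥0∞) :
    ∫⁻ l, F l ∂listExp μ = ∑' n, (n ! : ℝ≥0∞)⁻¹ * ∫⁻ l, F l ∂listPow μ n := by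
  simp [listExp, lintegral_sum_measure]

theorem lintegral_listPow_zero (μ : Measure α) {F : List α → ℝ≥0∞} (hF : Measurable F) :
    ∫⁻ l, F l ∂listPow μ 0 = F [] := by
  have hF' : Measurable fun v : Fin 0 → α => F (List.ofFn v) := by fun_prop
  rw [lintegral_listPow _ _ hF, Measure.pi_of_empty _ default, lintegral_dirac' _ hF']
  simp

instance (μ : Measure α) [IsFiniteMeasure μ] (n : ℕ) : IsFiniteMeasure (listPow μ n) := by
  unfold listPow; infer_instance

theorem lintegral_listPow_succ (μ : Measure α) [IsFiniteMeasure μ] (n : ℕ) {F : List α → ℝ≥0∞}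
    (hF : Measurable F) :
    ∫⁻ l, F l ∂listPow μ (n + 1) = ∫⁻ x, ∫⁻ l, F (x :: l) ∂listPow μ n ∂μ := by
  have hF' : Measurable fun v : Fin (n + 1) → α => F (List.ofFn v) := by fun_prop
  rw [lintegral_listPow _ _ hF,
    ← (measurePreserving_piFinSuccAbove (fun _ : Fin (n + 1) => μ) 0).symm.lintegral_comp hF',
    lintegral_prod]
  · refine lintegral_congr fun x => ?_
    rw [lintegral_listPow _ _ (by fun_prop)]
    simp [MeasurableEquiv.piFinSuccAbove, List.ofFn_succ]
  · exact (hF'.comp (MeasurableEquiv.measurable _)).aemeasurable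

theorem lintegral_listPow_smul (μ : Measure α) [IsFiniteMeasure μ] (c : ℝ≥0) (n : ℕ)
    {F : List α → ℝ≥0∞} (hF : Measurable F) :
    ∫⁻ l, F l ∂listPow (c • μ) n = c ^ n * ∫⁻ l, F l ∂listPow μ n := by
  induction n generalizing F with
  | zero => simp [lintegral_listPow_zero _ hF]
  | succ n ih =>
    have hm : Measurable fun x => ∫⁻ l, F (x :: l) ∂listPow μ n :=
      Measurable.lintegral_prod_right' (f := fun x : α × List α => F (x.1 :: x.2)) (by fun_prop)
    rw [lintegral_listPow_succ _ _ hF, lintegral_listPow_succ _ _ hF]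
    simp_rw [fun x => ih (F := fun l => F (x :: l)) (by fun_prop)]
    rw [lintegral_const_mul _ hm, lintegral_smul_measure, pow_succ, ENNReal.smul_def, smul_eq_mul]
    ring

/-! ### Thinning. -/

section Thinning

variable {μ : Measure α} {σ : Measure β} [IsFiniteMeasure μ] [IsFiniteMeasure σ]
  {g : α → Option β} {a : ℝ≥0∞}

/-- Binomial expansion: each of the `n` points is either removed, with mass `a`, or kept, with
intensity `σ`; `ij.1` counts the removed ones. The hypothesis `h` says this for one point, with `c`
the value on removal. -/
theorem lintegral_filterMap_listPow (hg : Measurable (List.filterMap g))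
    (h : ∀ (c : ℝ≥0∞) (f : β → ℝ≥0∞), Measurable f →
      ∫⁻ x, (g x).elim c f ∂μ = a * c + ∫⁻ y, f y ∂σ) (n : ℕ)
    {F : List β → ℝ≥0∞} (hF : Measurable F) :
    ∫⁻ l, F (l.filterMap g) ∂listPow μ n =
      ∑ ij ∈ Finset.HasAntidiagonal.antidiagonal n, (n.choose ij.1 : ℝ≥0∞) *
        (a ^ ij.1 * ∫⁻ l, F l ∂listPow σ ij.2) := by
  have hFg : ∀ {F : List β → ℝ≥0∞}, Measurable F → Measurable fun l => F (List.filterMap g l) :=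
    fun hF => hF.comp hg
  induction n generalizing F with
  | zero =>
    rw [lintegral_listPow_zero _ (hFg hF)]
    simp [lintegral_listPow_zero _ hF]
  | succ n ih =>
    have hm : ∀ k, Measurable fun x => ∫⁻ l, F (x :: l) ∂listPow σ k := fun k =>
      Measurable.lintegral_prod_right' (f := fun x : β × List β => F (x.1 :: x.2)) (by fun_prop)
    rw [lintegral_listPow_succ _ _ (hFg hF)]
    have hx : ∀ x, ∫⁻ l, F ((x :: l).filterMap g) ∂listPow μ n =
        (g x).elim (∫⁻ l, F (l.filterMap g) ∂listPow μ n)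
          (fun y => ∫⁻ l, F (y :: l.filterMap g) ∂listPow μ n) := by
      intro x
      rcases hgx : g x with _ | y <;> simp [hgx]
    simp_rw [hx]
    have hy : ∀ y, ∫⁻ l, F (y :: l.filterMap g) ∂listPow μ n = _ :=
      fun y => ih (F := fun l => F (y :: l)) (by fun_prop)
    simp_rw [hy]
    -- The first point is kept or removed; these two cases are the two sums of Pascal's rule.
    rw [h _ _ (Finset.measurable_sum _ fun ij _ => ((hm _).const_mul _).const_mul _), ih hF,
      Finset.sum_antidiagonal_choose_succ_mul (fun i j => a ^ i * ∫⁻ l, F l ∂listPow σ j), lintegral_finsetSum _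
        (fun ij _ => ((hm _).const_mul _).const_mul _), add_comm]
    congr 1
    · refine Finset.sum_congr rfl fun ij _ => ?_
      rw [lintegral_const_mul _ ((hm _).const_mul _), lintegral_const_mul _ (hm _),
        lintegral_listPow_succ _ _ hF]
    · rw [Finset.mul_sum]
      refine Finset.sum_congr rfl fun ij hij => ?_
      rw [← Finset.HasAntidiagonal.mem_antidiagonal.1 hij, Nat.choose_symm_add, pow_succ]
      ring

/-- Thinning: if `μ` is the sum of `σ` and a mass `a` of points which are removed by `g`, then
removing these points multiplies the exponential measure by `exp a`. -/
theorem map_filterMap_listExp (hg : Measurable (List.filterMap g))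
    (h : ∀ (c : ℝ≥0∞) (f : β → ℝ≥0∞), Measurable f →
      ∫⁻ x, (g x).elim c f ∂μ = a * c + ∫⁻ y, f y ∂σ) :
    (listExp μ).map (List.filterMap g) = (∑' n : ℕ, (n ! : ℝ≥0∞)⁻¹ * a ^ n) • listExp σ := by
  refine Measure.ext_of_lintegral _ fun F hF => ?_
  rw [lintegral_map hF hg, lintegral_listExp, lintegral_smul_measure, lintegral_listExp,
    smul_eq_mul, ← ENNReal.tsum_mul_right]
  simp_rw [lintegral_filterMap_listPow hg h _ hF, ← ENNReal.tsum_mul_left]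
  -- Cauchy product: the double series over removed and kept counts is regrouped by their sum `n`.
  rw [← ENNReal.tsum_prod, ← (Finset.HasAntidiagonal.sigmaAntidiagonalEquivProd (A := ℕ)).tsum_eq,
    ENNReal.tsum_sigma']
  refine tsum_congr fun n => ?_
  simp only [Finset.HasAntidiagonal.sigmaAntidiagonalEquivProd_apply]
  rw [tsum_fintype, Finset.sum_coe_sort (Finset.HasAntidiagonal.antidiagonal n)
    (fun ij => (ij.1 ! : ℝ≥0∞)⁻¹ * a ^ ij.1 * ((ij.2 ! : ℝ≥0∞)⁻¹ * ∫⁻ l, F l ∂listPow σ ij.2)),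
    Finset.mul_sum]
  refine Finset.sum_congr rfl fun ij hij => ?_
  have : ((n ! : ℝ≥0∞)⁻¹) * (n.choose ij.1 : ℝ≥0∞) =
      (ij.1 ! : ℝ≥0∞)⁻¹ * (ij.2 ! : ℝ≥0∞)⁻¹ := by
    have hin : ij.1 ≤ n := by
      have := Finset.HasAntidiagonal.mem_antidiagonal.1 hij
      omega
    have hn : n.choose ij.1 * (ij.1 ! * ij.2 !) = n ! := by
      rw [← Nat.choose_mul_factorial_mul_factorial hin, mul_assoc,
        ← Finset.HasAntidiagonal.mem_antidiagonal.1 hij, Nat.add_sub_cancel_left]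
    have hC : (n.choose ij.1 : ℝ≥0∞) ≠ 0 := by exact_mod_cast (Nat.choose_pos hin).ne'
    rw [← ENNReal.mul_inv (by simp) (by simp), ← hn]
    push_cast
    rw [ENNReal.mul_inv (.inl hC) (by simp), mul_right_comm, ENNReal.inv_mul_cancel hC (by simp),
      one_mul]
  rw [← mul_assoc, this]
  ring

end Thinning

/-- The factor `rⁿ` of the Poisson weight is absorbed into the `n`-th power of `r • κ`, leaving
`e^{-r} / n!`. The kernel `B` stands for everything done after the candidates are drawn. -/
theorem bind_poissonMeasure_eq {κ : Measure α} [IsProbabilityMeasure κ] (r : ℝ≥0)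
    {B : List α → Measure β} (hB : Measurable B) :
    ((poissonMeasure r).bind fun n => (Measure.pi fun _ : Fin n => κ).bind fun c =>
      B (List.ofFn c)) = ENNReal.ofReal (Real.exp (-r)) • (listExp (r • κ)).bind B := by
  refine Measure.ext_of_lintegral _ fun F hF => ?_
  have hm : Measurable fun l => ∫⁻ y, F y ∂B l := (Measure.measurable_lintegral hF).comp hB
  rw [Measure.lintegral_bind (by fun_prop) hF.aemeasurable, lintegral_smul_measure,
    Measure.lintegral_bind hB.aemeasurable hF.aemeasurable, lintegral_listExp, smul_eq_mul,
    ← ENNReal.tsum_mul_left, poissonMeasure, lintegral_sum_measure]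
  refine tsum_congr fun n => ?_
  have hB' : Measurable fun c : Fin n → α => B (List.ofFn c) := by fun_prop
  rw [lintegral_smul_measure, lintegral_dirac,
    Measure.lintegral_bind hB'.aemeasurable hF.aemeasurable,
    lintegral_listPow_smul _ _ _ hm, lintegral_listPow _ _ hm, smul_eq_mul, ← mul_assoc,
    ← mul_assoc]
  congr 1
  rw [mul_div_assoc, ENNReal.ofReal_mul (Real.exp_pos _).le, mul_assoc]
  congr 1
  rw [div_eq_inv_mul, ENNReal.ofReal_mul (by positivity), ENNReal.ofReal_inv_of_pos (by positivity),
    ENNReal.ofReal_natCast, ENNReal.ofReal_pow (NNReal.coe_nonneg r)]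
  simp

end ListExp

/-! ### Exchangeability -/

section Exchange

variable {M : Type*}

theorem diffs_ofFn {n : ℕ} (c : ℝ) (u : Fin n → ℝ) (q : Fin n → M) :
    diffs c (List.ofFn fun k => (u k, q k)) =
      List.ofFn fun k : Fin n => (Real.toNNReal (u k -
        if (k : ℕ) = 0 then c else u ⟨(k : ℕ) - 1, (Nat.sub_le _ _).trans_lt k.isLt⟩), q k) := by
  induction n generalizing c with
  | zero => simp [diffs]
  | succ n ih =>
    rw [List.ofFn_succ, diffs, ih, List.ofFn_succ]
    simp only [Fin.val_zero, if_true]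
    congr 2
    funext k
    rcases k with ⟨_ | k, hk⟩ <;> simp

/-- The permutation depends on the times only and serves all mark vectors `p` at once; this allows a
change of variables in the marks at fixed times. -/
theorem exists_perm_sort {n : ℕ} (t : Fin n → ℝ) :
    ∃ s : Equiv.Perm (Fin n), ∀ p : Fin n → M, diffs 0 (timeSort (List.ofFn fun k => (t k, p k))) =
      List.ofFn fun k => (cost t k, p (s k)) := by
  set L := (List.finRange n).insertionSort (fun i j => t i ≤ t j) with hL
  have hlen : L.length = n := by simp [hL]
  have hnd : L.Nodup := ((List.perm_insertionSort _ _).nodup_iff).2 (List.nodup_finRange n)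
  have hinj : Function.Injective fun k : Fin n => L.get (k.cast hlen.symm) := by
    intro i j hij
    simpa using hnd.injective_get hij
  let s : Equiv.Perm (Fin n) := Equiv.ofBijective _ (Finite.injective_iff_bijective.1 hinj)
  have hs : ∀ k, s k = L.get (k.cast hlen.symm) := fun k => rfl
  have hmap : ∀ {A : Type _} (f : Fin n → A), L.map f = List.ofFn fun k => f (s k) := by
    intro A f
    refine List.ext_getElem (by simp [hlen]) fun i h1 h2 => ?_
    simp [hs]
  have : Std.Total fun i j : Fin n => t i ≤ t j := ⟨fun i j => le_total _ _⟩
  have : IsTrans (Fin n) fun i j : Fin n => t i ≤ t j := ⟨fun i j k => le_trans⟩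
  have hsort : L.Pairwise fun i j => t i ≤ t j := List.pairwise_insertionSort _ _
  have hmono : Monotone (t ∘ s) := by
    intro i j hij
    rcases hij.eq_or_lt with rfl | hij
    · rfl
    · exact List.pairwise_iff_get.1 hsort (i.cast hlen.symm) (j.cast hlen.symm) hij
  -- With ties `s` may differ from `Tuple.sort t`, but the sorted values agree.
  have hst : ∀ k, sortedTime t k = t (s k) := fun k =>
    (congrFun (Tuple.comp_sort_eq_comp_iff_monotone.2 hmono) k).symm
  refine ⟨s, fun p => ?_⟩
  have h1 : timeSort (List.ofFn fun k => (t k, p k)) = List.ofFn fun k => (t (s k), p (s k)) := by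
    rw [← hmap (fun k => (t k, p k)), hL, List.map_insertionSort (fun i j => t i ≤ t j) timeLE,
      List.ofFn_eq_map]
    · rfl
    · intro a _ b _
      exact Iff.rfl
  rw [h1, diffs_ofFn (u := fun k => t (s k))]
  simp [cost, hst]

variable [MeasurableSpace M]

theorem measurable_diffs_timeSort : Measurable fun l : List (ℝ × M) => diffs 0 (timeSort l) :=
  measurable_diffs.comp (measurable_const.prodMk measurable_timeSort)

/-- Costs are read off from the measurable sort-and-difference map with trivial marks. -/
theorem measurable_cost {n : ℕ} : Measurable fun (t : Fin n → ℝ) (k : Fin n) => cost t k := by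
  have h : Measurable fun (t : Fin n → ℝ) => diffs 0 (timeSort (List.ofFn fun k => (t k, ()))) :=
    measurable_diffs_timeSort.comp ((measurable_ofFn n).comp (by fun_prop))
  have h' : Measurable fun (t : Fin n → ℝ) => List.ofFn fun k => (cost t k, ()) := by
    convert h using 2 with t
    obtain ⟨s, hs⟩ := exists_perm_sort (M := Unit) t
    exact (hs fun _ => ()).symm
  have := (measurableEmbedding_ofFn n).measurable_comp_iff.1 h'
  exact measurable_pi_iff.2 fun k => measurable_fst.comp (measurable_pi_iff.1 this k)

/-- Exchangeability: at fixed times, sorting permutes the marks, and the product measure of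
identical factors is invariant under this permutation. -/
theorem lintegral_costs_eq (U : Measure ℝ) [IsFiniteMeasure U] (σ : Measure M) [IsFiniteMeasure σ]
    (n : ℕ) {F : List (ℝ≥0 × M) → ℝ≥0∞} (hF : Measurable F) :
    ∫⁻ p, ∫⁻ t, F (List.ofFn fun k => (cost t k, p k)) ∂Measure.pi (fun _ : Fin n => U)
        ∂Measure.pi (fun _ : Fin n => σ) =
      ∫⁻ l, F (diffs 0 (timeSort l)) ∂listPow (U.prod σ) n := by
  have hc : Measurable fun x : (Fin n → M) × (Fin n → ℝ) =>
      F (List.ofFn fun k => (cost x.2 k, x.1 k)) := by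
    refine hF.comp ((measurable_ofFn n).comp (measurable_pi_iff.2 fun k => ?_))
    exact ((measurable_pi_iff.1 measurable_cost k).comp measurable_snd).prodMk (by fun_prop)
  have hd : Measurable fun l : List (ℝ × M) => F (diffs 0 (timeSort l)) :=
    hF.comp measurable_diffs_timeSort
  have hd' : Measurable fun v : Fin n → ℝ × M => F (diffs 0 (timeSort (List.ofFn v))) :=
    hd.comp (measurable_ofFn n)
  have hU := measurePreserving_arrowProdEquivProdArrow ℝ M (Fin n) (fun _ => U) (fun _ => σ)
  rw [lintegral_lintegral_swap hc.aemeasurable, lintegral_listPow _ _ hd,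
    ← hU.symm.lintegral_comp hd', lintegral_prod]
  · refine lintegral_congr fun t => ?_
    obtain ⟨s, hs⟩ := exists_perm_sort (M := M) t
    have hp := measurePreserving_piCongrLeft (fun _ : Fin n => σ) s.symm
    have hc' : Measurable fun p : Fin n → M => F (List.ofFn fun k => (cost t k, p k)) :=
      hc.comp (f := fun p => (p, t)) (by fun_prop)
    rw [← hp.lintegral_comp hc']
    refine lintegral_congr fun p => ?_
    refine congrArg F ?_
    trans List.ofFn fun k => (cost t k, p (s k))
    · congr 1
      funext k
      simp [MeasurableEquiv.piCongrLeft, Equiv.piCongrLeft_apply]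
    · rw [← hs]
      rfl
  · exact (hd'.comp (MeasurableEquiv.measurable _)).aemeasurable

end Exchange

/-! ### The law of a candidate in one dimension -/

section SideLaw

/-- The sum telescopes. It is the tail of a truncated geometric length, which is at least `j` with
probability `x ^ (j - 1)`. -/
theorem sum_pow_mul_add_pow (x : ℝ) {j L : ℕ} (hj : 0 < j) (hL : j ≤ L) :
    ∑ l ∈ Finset.Ico j L, x ^ (l - 1) * (1 - x) + x ^ (L - 1) = x ^ (j - 1) := by
  induction L, hL using Nat.le_induction with
  | base => simp
  | succ L hL ih =>
    rw [Finset.sum_Ico_succ_top hL, ← ih]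
    obtain ⟨L, rfl⟩ : ∃ k, L = k + 1 := ⟨L - 1, by omega⟩
    simp only [Nat.add_sub_cancel, pow_succ]
    ring

/-- A segment started at `k` reaches `m` with probability `x ^ (m - k)`. Giving the border start `k
= 0` the weight `1` makes the total weight of the segments reaching `m` independent of `m`; this is
why the model treats the first position differently. -/
theorem sum_ite_mul_pow (x : ℝ) (m : ℕ) :
    ∑ k ∈ Finset.range (m + 1), (if k = 0 then 1 else 1 - x) * x ^ (m - k) = 1 := by
  induction m with
  | zero => simp
  | succ m ih =>
    rw [Finset.sum_range_succ]
    have : ∀ k ∈ Finset.range (m + 1), (if k = 0 then 1 else 1 - x) * x ^ (m + 1 - k) =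
        x * ((if k = 0 then 1 else 1 - x) * x ^ (m - k)) := by
      intro k hk
      rw [Nat.succ_sub (Nat.lt_succ_iff.1 (Finset.mem_range.1 hk)), pow_succ]
      ring
    rw [Finset.sum_congr rfl this, ← Finset.mul_sum, ih]
    simp

/-- If `a = x₀`, all starts from `y` to `x₀` contribute and `sum_ite_mul_pow` collapses them. If `a
> x₀`, the only start is `a` itself, which is not at the border `y` and so has weight `1 - x`. -/
theorem sum_ite_max_eq (x : ℝ) {y N x₀ a b : ℕ} (hy : y ≤ x₀) (hxa : x₀ ≤ a) (hab : a < b)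
    (hb : b ≤ y + N) :
    ∑ k ∈ Finset.range N, (if k = 0 then 1 else 1 - x) *
        (if max (y + k) x₀ = a then x ^ (b - (y + k) - 1) else 0) =
      x ^ (b - a - 1) * if a = x₀ then 1 else 1 - x := by
  by_cases h : a = x₀
  · subst h
    have hsub : Finset.range (a - y + 1) ⊆ Finset.range N :=
      Finset.range_subset_range.2 (by omega)
    rw [← Finset.sum_subset hsub, if_pos rfl]
    · refine Eq.trans ?_ (congrArg (x ^ (b - a - 1) * ·) (sum_ite_mul_pow x (a - y)))
      rw [Finset.mul_sum]
      refine Finset.sum_congr rfl fun k hk => ?_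
      rw [Finset.mem_range] at hk
      have e : b - (y + k) - 1 = b - a - 1 + (a - y - k) := by omega
      rw [if_pos (by omega : max (y + k) a = a), e, pow_add]
      ring
    · intro k _ hk
      rw [Finset.mem_range] at hk
      rw [if_neg (by omega : ¬ max (y + k) a = a), mul_zero]
  · rw [if_neg h, Finset.sum_eq_single (a - y)]
    · rw [if_neg (by omega), if_pos (by omega), mul_comm, Nat.add_sub_cancel' (hy.trans hxa)]
    · intro k _ hk
      rw [if_neg (by omega : ¬ max (y + k) x₀ = a), mul_zero]
    · intro hk
      rw [Finset.mem_range] at hk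
      omega

variable (θ : unitInterval)

theorem one_sub_coe_nonneg : (0 : ℝ) ≤ 1 - θ := sub_nonneg.2 θ.2.2

theorem lengthLaw_Icc {j L : ℕ} (hj : 0 < j) (hL : j ≤ L) :
    lengthLaw θ L (Set.Icc j L) = ENNReal.ofReal ((θ : ℝ) ^ (j - 1)) := by
  have h1 := one_sub_coe_nonneg θ
  have h0 := θ.2.1
  rw [← sum_pow_mul_add_pow _ hj hL, ENNReal.ofReal_add (Finset.sum_nonneg fun _ _ => by positivity)
    (by positivity), ENNReal.ofReal_sum_of_nonneg fun _ _ => by positivity, lengthLaw,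
    Measure.add_apply, Measure.finsetSum_apply]
  congr 1
  · have hsub : Finset.Ico j L ⊆ Finset.Ico 1 L := Finset.Ico_subset_Ico_left hj
    rw [← Finset.sum_subset hsub]
    · refine Finset.sum_congr rfl fun l hl => ?_
      rw [Finset.mem_Ico] at hl
      simp [hl.1, hl.2.le]
    · intro l hl hl'
      rw [Finset.mem_Ico] at hl hl'
      have : ¬ j ≤ l := by omega
      simp [this]
  · simp [hL]

theorem lengthLaw_singleton {j L : ℕ} (hj : 0 < j) (hL : j < L) :
    lengthLaw θ L {j} = ENNReal.ofReal ((θ : ℝ) ^ (j - 1) * (1 - θ)) := by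
  rw [lengthLaw, Measure.add_apply, Measure.finsetSum_apply, Finset.sum_eq_single j]
  · simp [hL.ne']
  · intro l _ hl
    simp [hl]
  · intro h
    rw [Finset.mem_Ico] at h
    omega

theorem isProbabilityMeasure_lengthLaw {L : ℕ} (hL : 0 < L) :
    IsProbabilityMeasure (lengthLaw θ L) := by
  constructor
  have h1 := one_sub_coe_nonneg θ
  have h0 := θ.2.1
  have := sum_pow_mul_add_pow (θ : ℝ) one_pos hL
  simp only [lengthLaw, Measure.add_apply, Measure.finsetSum_apply, Measure.smul_apply,
    measure_univ, smul_eq_mul, mul_one]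
  rw [← ENNReal.ofReal_sum_of_nonneg fun _ _ => by positivity,
    ← ENNReal.ofReal_add (Finset.sum_nonneg fun _ _ => by positivity) (by positivity), this]
  simp

theorem isProbabilityMeasure_sideLaw {N : ℕ} (hN : 0 < N) :
    IsProbabilityMeasure (sideLaw θ N) := by
  have : IsProbabilityMeasure (uniformOn (Set.Icc 1 N)) :=
    isProbabilityMeasure_uniformOn (Set.finite_Icc 1 N) ⟨1, by simp; omega⟩
  unfold sideLaw
  refine isProbabilityMeasure_bind Measurable.of_discrete.aemeasurable (ae_of_all _ fun s => ?_)
  refine isProbabilityMeasure_bind Measurable.of_discrete.aemeasurable (ae_of_all _ fun b => ?_)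
  have := isProbabilityMeasure_lengthLaw θ (Nat.succ_pos (N - s))
  cases b
  · simp; infer_instance
  · simp
    exact Measure.isProbabilityMeasure_map (by fun_prop)

/-- Excluding length `0` from `S` kills the branch of the Bernoulli variable that yields an empty
segment. The index is `k = s - 1`. -/
theorem sideLaw_apply (N : ℕ) {S : Set (ℕ × ℕ)} (hS : ∀ s, (s, 0) ∉ S) :
    sideLaw θ N S = ∑ k ∈ Finset.range N, (N : ℝ≥0∞)⁻¹ *
      (ENNReal.ofReal (if k = 0 then 1 else 1 - θ) *
        lengthLaw θ (N - k) {l | (k + 1, l) ∈ S}) := by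
  have hu : ∀ f : ℕ → ℝ≥0∞, ∫⁻ s, f s ∂uniformOn (Set.Icc 1 N) =
      ∑ k ∈ Finset.range N, (N : ℝ≥0∞)⁻¹ * f (k + 1) := by
    intro f
    rw [uniformOn, ProbabilityTheory.cond, lintegral_smul_measure, ← Finset.coe_Icc,
      lintegral_finset, Measure.count_apply_finset, Finset.range_eq_Ico,
      Finset.sum_Ico_add' (fun s => (N : ℝ≥0∞)⁻¹ * f s), ← Finset.mul_sum]
    simp [Finset.Ico_add_one_right_eq_Icc]
  rw [sideLaw, Measure.bind_apply .of_discrete Measurable.of_discrete.aemeasurable, hu]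
  refine Finset.sum_congr rfl fun k hk => ?_
  rw [Finset.mem_range] at hk
  congr 1
  rw [Measure.bind_apply .of_discrete Measurable.of_discrete.aemeasurable, bernoulliMeasure_def,
    lintegral_add_measure, lintegral_smul_measure, lintegral_smul_measure, lintegral_dirac,
    lintegral_dirac]
  have hL : N - (k + 1) + 1 = N - k := by omega
  simp only [if_true, Bool.false_eq_true, if_false, Measure.dirac_apply]
  rw [Measure.map_apply (by fun_prop) (by measurability), hL, Set.indicator_of_notMem (hS _),
    smul_zero, add_zero]
  rw [ENNReal.smul_def, smul_eq_mul]
  congr 1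
  by_cases h : k = 0
  · simp only [h, if_true, ENNReal.ofReal_one]
    rfl
  · rw [if_neg h, if_neg (by omega), ENNReal.ofReal_eq_coe_nnreal (one_sub_coe_nonneg θ)]
    rfl

theorem Ico_eq_Ico_iff_of_lt {p q a b : ℕ} (hab : a < b) :
    Finset.Ico p q = Finset.Ico a b ↔ p = a ∧ q = b := by
  refine ⟨fun h => ?_, fun h => by rw [h.1, h.2]⟩
  have hm : ∀ x, (p ≤ x ∧ x < q) ↔ (a ≤ x ∧ x < b) := fun x => by
    simpa using Finset.ext_iff.1 h x
  have h1 := hm a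
  have h2 := hm (b - 1)
  have h3 := hm p
  have h4 := hm (q - 1)
  omega

/-- The intensity of the segments that start `y` places from the origin within a side of length `N`
and meet `Ico x₀ x₁` in `Ico a b`; it does not depend on `y` and `N`. -/
theorem mul_sideLaw_inter {y N x₀ x₁ a b : ℕ} (hy : y ≤ x₀) (hN : x₁ ≤ y + N) (hxa : x₀ ≤ a)
    (hab : a < b) (hb : b ≤ x₁) :
    N * sideLaw θ N {c | Finset.Ico (y + (c.1 - 1)) (y + (c.1 - 1) + c.2) ⊆ Finset.Ico y (y + N) ∧
        Finset.Ico (y + (c.1 - 1)) (y + (c.1 - 1) + c.2) ∩ Finset.Ico x₀ x₁ = Finset.Ico a b} =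
      ENNReal.ofReal ((θ : ℝ) ^ (b - a - 1) * (if a = x₀ then 1 else 1 - (θ : ℝ)) *
        if b < x₁ then 1 - (θ : ℝ) else 1) := by
  have h1 := one_sub_coe_nonneg θ
  have h0 := θ.2.1
  have hN0 : (N : ℝ≥0∞) ≠ 0 := by
    have : N ≠ 0 := by omega
    exact_mod_cast this
  have hc : (0 : ℝ) ≤ if b < x₁ then 1 - (θ : ℝ) else 1 := by split_ifs <;> simp [h1]
  have hq : ∀ k : ℕ, (0 : ℝ) ≤ if k = 0 then 1 else 1 - (θ : ℝ) := by intro k; split_ifs <;> simp [h1]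
  rw [sideLaw_apply]
  · rw [← Finset.mul_sum, ← mul_assoc, ENNReal.mul_inv_cancel hN0 (by simp), one_mul,
      ← sum_ite_max_eq (θ : ℝ) hy hxa hab (hb.trans hN), Finset.sum_mul,
      ENNReal.ofReal_sum_of_nonneg]
    · refine Finset.sum_congr rfl fun k hk => ?_
      rw [Finset.mem_range] at hk
      rw [mul_assoc, ENNReal.ofReal_mul (hq k)]
      congr 1
      have hS : ∀ l, (k + 1, l) ∈ {c : ℕ × ℕ |
          Finset.Ico (y + (c.1 - 1)) (y + (c.1 - 1) + c.2) ⊆ Finset.Ico y (y + N) ∧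
          Finset.Ico (y + (c.1 - 1)) (y + (c.1 - 1) + c.2) ∩ Finset.Ico x₀ x₁ = Finset.Ico a b} ↔
          l ≤ N - k ∧ max (y + k) x₀ = a ∧ min (y + k + l) x₁ = b := by
        intro l
        rw [Set.mem_ofPred_eq, Finset.Ico_inter_Ico, Ico_eq_Ico_iff_of_lt hab]
        simp only [Nat.add_sub_cancel]
        constructor
        · rintro ⟨hs, h⟩
          rw [Finset.Ico_subset_Ico_iff (by omega)] at hs
          omega
        · rintro ⟨hl, h⟩
          exact ⟨Finset.Ico_subset_Ico (by omega) (by omega), h⟩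
      simp_rw [hS]
      by_cases hmax : max (y + k) x₀ = a
      · rw [if_pos hmax]
        by_cases hbx : b < x₁
        · rw [if_pos hbx, ← lengthLaw_singleton θ (L := N - k) (by omega) (by omega)]
          congr 1
          ext l
          simp only [Set.mem_ofPred_eq, Set.mem_singleton_iff]
          omega
        · rw [if_neg hbx, mul_one, ← lengthLaw_Icc θ (L := N - k) (by omega) (by omega)]
          congr 1
          ext l
          simp only [Set.mem_ofPred_eq, Set.mem_Icc]
          omega
      · simp [hmax]
    · intro k _
      refine mul_nonneg (mul_nonneg (hq k) ?_) hc
      split_ifs <;> positivity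
  · rintro s ⟨-, h⟩
    have := Finset.ext_iff.1 h a
    simp at this
    omega

end SideLaw

/-! ### The law of a candidate -/

section Candidate

variable {D : ℕ} (θ : unitInterval)

instance (X : SubArray D) (d : Fin D) : IsProbabilityMeasure (sideLaw θ (X.len d)) :=
  isProbabilityMeasure_sideLaw θ (X.len_pos d)

instance (X : SubArray D) : IsProbabilityMeasure (candidateLaw θ X) := by
  unfold candidateLaw; infer_instance

theorem ofCandidate_eq_some_iff {X : SubArray D} {c : Fin D → ℕ × ℕ} {p : Patch X} :
    ofCandidate X c = some p ↔ ∀ d, X.cells d (c d) = p.u d := by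
  unfold ofCandidate
  constructor
  · intro h d
    split_ifs at h with h'
    rw [Option.some.injEq] at h
    rw [← h]
  · intro h
    have h' : ∀ d, 0 < (c d).2 ∧ X.cells d (c d) ⊆ X.side d := fun d => by
      refine ⟨Nat.pos_of_ne_zero fun h0 => ?_, (h d).symm ▸ p.subset d⟩
      have := (h d).symm ▸ (p.isSegment d).nonempty
      simp [SubArray.cells, h0] at this
    rw [dif_pos h']
    congr 1
    ext1
    funext d
    exact h d

theorem ofCandidate_bind_restrict_eq_some_iff {X Y : SubArray D} {c : Fin D → ℕ × ℕ}
    {q : Patch X} : (ofCandidate Y c).bind (Patch.restrict X) = some q ↔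
      ∀ d, Y.cells d (c d) ⊆ Y.side d ∧ Y.cells d (c d) ∩ X.side d = q.u d := by
  rw [Option.bind_eq_some_iff]
  constructor
  · rintro ⟨p, hp, hq⟩ d
    rw [ofCandidate_eq_some_iff.1 hp d]
    exact ⟨p.subset d, Patch.restrict_eq_some_iff.1 hq d⟩
  · intro h
    have hne : ∀ d, (Y.cells d (c d)).Nonempty := fun d =>
      ((q.isSegment d).nonempty).mono ((h d).2 ▸ Finset.inter_subset_left)
    have hseg : ∀ d, IsSegment (Y.cells d (c d)) := fun d =>
      ⟨_, _, Nat.pos_of_ne_zero fun h0 => by simpa [SubArray.cells, h0] using hne d, rfl⟩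
    exact ⟨⟨fun d => Y.cells d (c d), hseg, fun d => (h d).1⟩,
      ofCandidate_eq_some_iff.2 fun _ => rfl, Patch.restrict_eq_some_iff.2 fun d => (h d).2⟩

theorem volume_mul_candidateLaw {X Y : SubArray D} (q : Patch X) :
    Y.volume * candidateLaw θ Y {c | (ofCandidate Y c).bind (Patch.restrict X) = some q} =
      ∏ d, Y.len d * sideLaw θ (Y.len d)
        {c | Y.cells d c ⊆ Y.side d ∧ Y.cells d c ∩ X.side d = q.u d} := by
  have : {c | (ofCandidate Y c).bind (Patch.restrict X) = some q} = Set.univ.pi fun d =>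
      {c | Y.cells d c ⊆ Y.side d ∧ Y.cells d c ∩ X.side d = q.u d} := by
    ext c
    simp [ofCandidate_bind_restrict_eq_some_iff]
  rw [this, candidateLaw, Measure.pi_pi, SubArray.volume, Nat.cast_prod, Finset.prod_mul_distrib]

/-- The intensity with which candidates of `Y` restrict to a given patch of `X` does not depend
on `Y`. -/
theorem volume_mul_candidateLaw_restrict {X Y : SubArray D} (h : X ≤ Y) (q : Patch X) :
    Y.volume * candidateLaw θ Y {c | (ofCandidate Y c).bind (Patch.restrict X) = some q} =
      X.volume * candidateLaw θ X {c | ofCandidate X c = some q} := by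
  -- Restricting `X` to itself does nothing, so both sides become instances of one formula whose
  -- value involves neither `y` nor `N`.
  have hX : {c | ofCandidate X c = some q} =
      {c | (ofCandidate X c).bind (Patch.restrict X) = some q} := by
    ext c
    simp [Patch.restrict_self]
  rw [hX, volume_mul_candidateLaw, volume_mul_candidateLaw]
  refine Finset.prod_congr rfl fun d _ => ?_
  obtain ⟨a, l, hl, hu⟩ := q.isSegment d
  have hq := q.subset d
  have hd := h d
  have hpos := X.len_pos d
  rw [hu] at hq ⊢
  unfold SubArray.side at hq hd
  rw [Finset.Ico_subset_Ico_iff (by omega)] at hq hd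
  unfold SubArray.side SubArray.cells
  rw [mul_sideLaw_inter θ hd.1 hd.2 hq.1 (by omega) hq.2,
    mul_sideLaw_inter θ le_rfl le_rfl hq.1 (by omega) hq.2]

end Candidate

/-! ### The intensity of the patches -/

section Intensity

variable {D : ℕ}

instance (X : SubArray D) : Fintype (Patch X) := Fintype.ofFinite _

instance (X : SubArray D) : Inhabited (Patch X) :=
  ⟨⟨X.side, fun d => ⟨X.lo d, X.len d, X.len_pos d, rfl⟩, fun _ => subset_rfl⟩⟩

theorem lintegral_option_elim {α β : Type*} [MeasurableSpace α] [Fintype β] (μ : Measure α)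
    {g : α → Option β} (hg : ∀ o, MeasurableSet {x | g x = o}) (c : ℝ≥0∞) (f : β → ℝ≥0∞) :
    ∫⁻ x, (g x).elim c f ∂μ = μ {x | g x = none} * c + ∑ q, μ {x | g x = some q} * f q := by
  have h : ∀ x, (g x).elim c f = {x | g x = none}.indicator (fun _ => c) x +
      ∑ q, {x | g x = some q}.indicator (fun _ => f q) x := by
    intro x
    rcases hx : g x with _ | q
    · simp [Set.indicator, hx]
    · rw [Finset.sum_eq_single q]
      · simp [Set.indicator, hx]
      · intro r _ hr
        simp [Set.indicator, hx, hr.symm]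
      · simp
  simp_rw [h]
  rw [lintegral_add_left (measurable_const.indicator (hg _)), lintegral_finsetSum _
    fun q _ => measurable_const.indicator (hg _)]
  simp_rw [lintegral_indicator_const (hg _), mul_comm]

/-- The intensity measure of the unrestricted candidates of `SPP(X, τ)`. -/
def candidateIntensity (θ : unitInterval) (τ : ℝ≥0) (X : SubArray D) :
    Measure (Fin D → ℕ × ℕ) :=
  (τ * X.volume : ℝ≥0) • candidateLaw θ X

instance (θ : unitInterval) (τ : ℝ≥0) (X : SubArray D) :
    IsFiniteMeasure (candidateIntensity θ τ X) := by
  unfold candidateIntensity; infer_instance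

/-- The intensity measure of the patches of `SPP(X, τ)`. -/
def patchIntensity (θ : unitInterval) (τ : ℝ≥0) (X : SubArray D) : Measure (Patch X) :=
  ∑ q, candidateIntensity θ τ X {c | ofCandidate X c = some q} • Measure.dirac q

variable (θ : unitInterval) (τ : ℝ≥0)

theorem lintegral_patchIntensity (X : SubArray D) (f : Patch X → ℝ≥0∞) :
    ∫⁻ q, f q ∂patchIntensity θ τ X =
      ∑ q, candidateIntensity θ τ X {c | ofCandidate X c = some q} * f q := by
  simp [patchIntensity, lintegral_finsetSum_measure]

instance (X : SubArray D) : IsFiniteMeasure (patchIntensity θ τ X) := by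
  constructor
  rw [← lintegral_one, lintegral_patchIntensity]
  exact ENNReal.sum_lt_top.2 fun q _ => by simp [measure_lt_top]

theorem lintegral_ofCandidate_elim (X : SubArray D) (c : ℝ≥0∞) (f : Patch X → ℝ≥0∞) :
    ∫⁻ x, (ofCandidate X x).elim c f ∂candidateIntensity θ τ X =
      candidateIntensity θ τ X {x | ofCandidate X x = none} * c +
        ∫⁻ q, f q ∂patchIntensity θ τ X := by
  rw [lintegral_option_elim _ (fun _ => .of_discrete), lintegral_patchIntensity]

/-- Consistency of the intensities, transferred from candidates to patches: empty candidates and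
patches that miss `X` contribute `0`. -/
theorem patchIntensity_restrict {X Y : SubArray D} (h : X ≤ Y) (q : Patch X) :
    patchIntensity θ τ Y {p | p.restrict X = some q} =
      candidateIntensity θ τ X {c | ofCandidate X c = some q} := by
  have hi := lintegral_ofCandidate_elim θ τ Y 0 ({p | p.restrict X = some q}.indicator 1)
  rw [mul_zero, zero_add, lintegral_indicator_one .of_discrete] at hi
  have hind : ∀ x, (ofCandidate Y x).elim 0 ({p | p.restrict X = some q}.indicator 1) =
      {x | (ofCandidate Y x).bind (Patch.restrict X) = some q}.indicator
        (1 : (Fin D → ℕ × ℕ) → ℝ≥0∞) x := by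
    intro x
    by_cases hx : ofCandidate Y x = none
    · simp [Set.indicator, hx]
    · obtain ⟨p, hp⟩ := Option.ne_none_iff_exists'.1 hx
      by_cases hq : p.restrict X = some q
      · rw [hp, Option.elim_some, Set.indicator_of_mem (by exact hq),
          Set.indicator_of_mem (by simp [hp, hq])]
        rfl
      · rw [hp, Option.elim_some, Set.indicator_of_notMem (by exact hq),
          Set.indicator_of_notMem (by simp [hp, hq])]
  simp_rw [hind] at hi
  rw [lintegral_indicator_one .of_discrete] at hi
  rw [← hi]
  simp only [candidateIntensity, Measure.smul_apply, ENNReal.smul_def, smul_eq_mul,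
    ENNReal.coe_mul, ENNReal.coe_natCast, mul_assoc]
  rw [volume_mul_candidateLaw_restrict θ h q]

/-- The hypothesis of the thinning lemma for restriction to `X`; the removed mass is the intensity
of the patches of `Y` that miss `X`. -/
theorem lintegral_restrictPoint_elim (U : Measure ℝ) [IsProbabilityMeasure U]
    {X Y : SubArray D} (h : X ≤ Y) (c : ℝ≥0∞) {f : ℝ × Patch X → ℝ≥0∞} (hf : Measurable f)
    (hm : Measurable fun x : ℝ × Patch Y => (restrictPoint X x).elim c f) :
    ∫⁻ x, (restrictPoint X x).elim c f ∂U.prod (patchIntensity θ τ Y) =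
      patchIntensity θ τ Y {p | p.restrict X = none} * c +
        ∫⁻ x, f x ∂U.prod (patchIntensity θ τ X) := by
  rw [lintegral_prod _ hm.aemeasurable, lintegral_prod _ hf.aemeasurable]
  have : ∀ t, ∫⁻ p, (restrictPoint X (t, p)).elim c f ∂patchIntensity θ τ Y =
      patchIntensity θ τ Y {p | p.restrict X = none} * c +
        ∫⁻ q, f (t, q) ∂patchIntensity θ τ X := by
    intro t
    have he : ∀ p : Patch Y, (restrictPoint X (t, p)).elim c f =
        (p.restrict X).elim c fun q => f (t, q) := by
      intro p
      rcases hp : p.restrict X with _ | q <;> simp [restrictPoint, hp]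
    simp_rw [he]
    rw [lintegral_option_elim _ (fun _ => .of_discrete), lintegral_patchIntensity]
    simp_rw [patchIntensity_restrict θ τ h]
  simp_rw [this]
  rw [lintegral_add_left measurable_const]
  simp

theorem measurable_filterMap_ofCandidate (X : SubArray D) :
    Measurable (List.filterMap (ofCandidate X)) :=
  measurable_filterMap .of_discrete (d := fun c => (ofCandidate X c).getD default)
    .of_discrete fun c p h => by simp [h]

theorem measurableSet_restrictPoint_eq_none (X Y : SubArray D) :
    MeasurableSet {x : ℝ × Patch Y | restrictPoint X x = none} := by
  have : {x : ℝ × Patch Y | restrictPoint X x = none} =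
      Prod.snd ⁻¹' {p : Patch Y | p.restrict X = none} := by
    ext x
    simp [restrictPoint]
  rw [this]
  exact measurable_snd .of_discrete

theorem measurable_restrictPoint_getD (X Y : SubArray D) :
    Measurable fun x : ℝ × Patch Y => (x.1, (x.2.restrict X).getD default) :=
  measurable_fst.prodMk ((Measurable.of_discrete
    (f := fun p : Patch Y => (p.restrict X).getD default)).comp measurable_snd)

theorem restrictPoint_eq_some {X Y : SubArray D} {x : ℝ × Patch Y} {y : ℝ × Patch X}
    (h : restrictPoint X x = some y) : (x.1, (x.2.restrict X).getD default) = y := by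
  rw [restrictPoint, Option.map_eq_some_iff] at h
  obtain ⟨q, hq, rfl⟩ := h
  simp [hq]

theorem measurable_filterMap_restrictPoint (X Y : SubArray D) :
    Measurable (List.filterMap (restrictPoint (Y := Y) X)) :=
  measurable_filterMap (measurableSet_restrictPoint_eq_none X Y)
    (measurable_restrictPoint_getD X Y) fun _ _ => restrictPoint_eq_some

theorem measurable_restrictPoint_elim (X Y : SubArray D) (c : ℝ≥0∞) {f : ℝ × Patch X → ℝ≥0∞}
    (hf : Measurable f) : Measurable fun x : ℝ × Patch Y => (restrictPoint X x).elim c f := by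
  classical
  have : (fun x : ℝ × Patch Y => (restrictPoint X x).elim c f) =
      fun x => if x ∈ {x : ℝ × Patch Y | restrictPoint X x = none} then c
        else f (x.1, (x.2.restrict X).getD default) := by
    funext x
    by_cases hx : restrictPoint X x = none
    · simp [hx]
    · obtain ⟨y, hy⟩ := Option.ne_none_iff_exists'.1 hx
      simp [hy, restrictPoint_eq_some hy]
  rw [this]
  exact Measurable.ite (measurableSet_restrictPoint_eq_none X Y) measurable_const
    (hf.comp (measurable_restrictPoint_getD X Y))

end Intensity

/-! ### The law of the partition -/

section Law

variable {D : ℕ} (θ : unitInterval) (τ : ℝ≥0)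

/-- The uniform law of a time point. -/
abbrev timeLaw : Measure ℝ := cond (volume : Measure ℝ) (Set.Ioc 0 (τ : ℝ))

theorem isProbabilityMeasure_timeLaw (hτ : 0 < τ) : IsProbabilityMeasure (timeLaw τ) :=
  cond_isProbabilityMeasure_of_finite (by simpa using hτ.ne') (by simp)

/-- The law of the partition whose patches are the given ones. -/
def assembleLaw {X : SubArray D} (ps : List (Patch X)) : Measure (List (ℝ≥0 × Patch X)) :=
  (Measure.pi fun _ : Fin ps.length => timeLaw τ).map (assemble ps)

theorem measurable_ofFn_cost {M : Type*} [MeasurableSpace M] {n : ℕ} (p : Fin n → M) :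
    Measurable fun t : Fin n → ℝ => List.ofFn fun k => (cost t k, p k) :=
  (measurable_ofFn n).comp (measurable_pi_iff.2 fun k =>
    (measurable_pi_iff.1 measurable_cost k).prodMk measurable_const)

theorem assembleLaw_ofFn {X : SubArray D} {n : ℕ} (p : Fin n → Patch X) :
    assembleLaw τ (List.ofFn p) = (Measure.pi fun _ : Fin n => timeLaw τ).map
      fun t => List.ofFn fun k => (cost t k, p k) := by
  -- The index type depends on `ps.length`; with the length equation as a variable, the transport
  -- disappears by substitution.
  have : ∀ (ps : List (Patch X)) (h : ps.length = n), assembleLaw τ ps =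
      (Measure.pi fun _ : Fin n => timeLaw τ).map
        fun t => List.ofFn fun k => (cost t k, ps.get (k.cast h.symm)) := by
    rintro ps rfl
    rfl
  rw [this _ (List.length_ofFn)]
  simp

theorem measurable_assembleLaw {X : SubArray D} :
    Measurable (assembleLaw τ : List (Patch X) → Measure (List (ℝ≥0 × Patch X))) :=
  measurable_list_iff.2 fun _ => .of_discrete

theorem law_eq_bind (X : SubArray D) : law θ τ X =
    (poissonMeasure (τ * X.volume)).bind fun n =>
      (Measure.pi fun _ : Fin n => candidateLaw θ X).bind fun c =>
        assembleLaw τ ((List.ofFn c).filterMap (ofCandidate X)) :=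
  rfl

theorem isProbabilityMeasure_law (hτ : 0 < τ) (X : SubArray D) :
    IsProbabilityMeasure (law θ τ X) := by
  have := isProbabilityMeasure_timeLaw τ hτ
  rw [law_eq_bind]
  refine isProbabilityMeasure_bind Measurable.of_discrete.aemeasurable (ae_of_all _ fun n => ?_)
  refine isProbabilityMeasure_bind Measurable.of_discrete.aemeasurable (ae_of_all _ fun c => ?_)
  exact Measure.isProbabilityMeasure_map (measurable_ofFn_cost _).aemeasurable

theorem bind_assembleLaw (hτ : 0 < τ) (X : SubArray D) (σ : Measure (Patch X))
    [IsFiniteMeasure σ] : (listExp σ).bind (assembleLaw τ) =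
      (listExp ((timeLaw τ).prod σ)).map fun l => diffs 0 (timeSort l) := by
  have := isProbabilityMeasure_timeLaw τ hτ
  refine Measure.ext_of_lintegral _ fun F hF => ?_
  have hm : Measurable fun l : List (Patch X) => ∫⁻ y, F y ∂assembleLaw τ l :=
    (Measure.measurable_lintegral hF).comp (measurable_assembleLaw τ)
  rw [Measure.lintegral_bind (measurable_assembleLaw τ).aemeasurable hF.aemeasurable,
    lintegral_map hF measurable_diffs_timeSort, lintegral_listExp, lintegral_listExp]
  refine tsum_congr fun n => ?_
  rw [lintegral_listPow _ _ hm, ← lintegral_costs_eq _ _ _ hF]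
  congr 1
  refine lintegral_congr fun p => ?_
  rw [assembleLaw_ofFn, lintegral_map hF (measurable_ofFn_cost p)]

/-- Up to normalization, the partition is obtained by sorting marked points. -/
theorem exists_law_eq_smul (hτ : 0 < τ) (X : SubArray D) : ∃ C : ℝ≥0∞, law θ τ X =
    C • (listExp ((timeLaw τ).prod (patchIntensity θ τ X))).map
      fun l => diffs 0 (timeSort l) := by
  have hg := measurable_filterMap_ofCandidate X
  -- The Poisson normalization times the exponential of the mass of empty candidates, from thinning.
  refine ⟨ENNReal.ofReal (Real.exp (-(τ * X.volume : ℝ≥0))) * ∑' n : ℕ, (n.factorial : ℝ≥0∞)⁻¹ *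
    candidateIntensity θ τ X {x | ofCandidate X x = none} ^ n, ?_⟩
  have hA := measurable_assembleLaw (X := X) τ
  have hB : Measurable fun l : List (Fin D → ℕ × ℕ) => assembleLaw τ (l.filterMap (ofCandidate X)) := hA.comp hg
  have hmap := map_filterMap_listExp hg fun c f _ => lintegral_ofCandidate_elim θ τ X c f
  rw [← bind_assembleLaw τ hτ, law_eq_bind, bind_poissonMeasure_eq _ hB]
  refine Measure.ext_of_lintegral _ fun F hF => ?_
  have hm : Measurable fun l : List (Patch X) => ∫⁻ y, F y ∂assembleLaw τ l :=
    (Measure.measurable_lintegral hF).comp hA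
  rw [lintegral_smul_measure, lintegral_smul_measure,
    Measure.lintegral_bind hB.aemeasurable hF.aemeasurable,
    Measure.lintegral_bind hA.aemeasurable hF.aemeasurable, smul_eq_mul, smul_eq_mul, mul_assoc,
    ← smul_eq_mul (∑' _, _), ← lintegral_smul_measure, ← hmap, lintegral_map hm hg]
  rfl

theorem ae_forall_mem_listExp {α : Type*} [MeasurableSpace α] {μ : Measure α} [IsFiniteMeasure μ]
    {P : α → Prop} (h : ∀ᵐ x ∂μ, P x) : ∀ᵐ l ∂listExp μ, ∀ x ∈ l, P x := by
  rw [listExp, Measure.ae_sum_iff]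
  intro n
  refine Measure.ae_smul_measure ?_ _
  rw [listPow, (measurableEmbedding_ofFn n).ae_map_iff]
  simp only [List.forall_mem_ofFn_iff]
  exact ae_all_iff.2 fun i => Measure.tendsto_eval_ae_ae.eventually h

/-- Both laws are multiples of the same measure `m`, and total mass `1` forces each constant to be
the inverse of the mass of `m`. -/
theorem map_restrict_law (hτ : 0 < τ) {X Y : SubArray D} (h : X ≤ Y) :
    (law θ τ Y).map (Partition.restrict h) = law θ τ X := by
  have := isProbabilityMeasure_timeLaw τ hτ
  have hX := isProbabilityMeasure_law θ τ hτ X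
  have hY := isProbabilityMeasure_law θ τ hτ Y
  have hYX : IsProbabilityMeasure ((law θ τ Y).map (Partition.restrict h)) :=
    Measure.isProbabilityMeasure_map (measurable_restrict h).aemeasurable
  obtain ⟨C, hC⟩ := exists_law_eq_smul θ τ hτ X
  obtain ⟨C', hC'⟩ := exists_law_eq_smul θ τ hτ Y
  -- Commuting restriction with differencing needs times after the origin, which holds almost
  -- surely.
  have hpos : ∀ᵐ x ∂(timeLaw τ).prod (patchIntensity θ τ Y), 0 < x.1 :=
    Measure.quasiMeasurePreserving_fst.ae
      ((ae_cond_mem measurableSet_Ioc).mono fun t ht => ht.1)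
  have key : ((listExp ((timeLaw τ).prod (patchIntensity θ τ Y))).map
      fun l => diffs 0 (timeSort l)).map (restrictAux X 0) =
      ((listExp ((timeLaw τ).prod (patchIntensity θ τ Y))).map
        (List.filterMap (restrictPoint X))).map fun l => diffs 0 (timeSort l) := by
    have hr : Measurable (restrictAux (Y := Y) X 0) := measurable_restrict h
    rw [Measure.map_map hr measurable_diffs_timeSort,
      Measure.map_map measurable_diffs_timeSort (measurable_filterMap_restrictPoint X Y)]
    refine Measure.map_congr ?_
    filter_upwards [ae_forall_mem_listExp hpos] with l hl
    exact restrict_diffs_timeSort l hl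
  rw [map_filterMap_listExp (measurable_filterMap_restrictPoint X Y) fun c f hf =>
    lintegral_restrictPoint_elim θ τ _ h c hf (measurable_restrictPoint_elim X Y c hf),
    Measure.map_smul] at key
  set m : Measure (List (ℝ≥0 × Patch X)) :=
    (listExp ((timeLaw τ).prod (patchIntensity θ τ X))).map fun l => diffs 0 (timeSort l) with hm
  obtain ⟨C'', hC''⟩ : ∃ C'' : ℝ≥0∞, (law θ τ Y).map (Partition.restrict h) = C'' • m := by
    refine ⟨C' * ∑' n : ℕ, (n.factorial : ℝ≥0∞)⁻¹ *
      patchIntensity θ τ Y {p | p.restrict X = none} ^ n, ?_⟩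
    rw [hC', mul_smul, ← key]
    exact Measure.map_smul _ _ _
  have h1 : C * m Set.univ = 1 := by
    have := hX.measure_univ
    rw [hC] at this
    exact this
  have h2 : C'' * m Set.univ = 1 := by
    have := hYX.measure_univ
    rw [hC''] at this
    exact this
  rw [hC'', hC, ENNReal.eq_inv_of_mul_eq_one_left h1, ENNReal.eq_inv_of_mul_eq_one_left h2]

end Law

/-! ### Lists in a standard Borel space -/

section StandardBorel

theorem borelSpace_sigma {ι : Type*} [Countable ι] {A : ι → Type*} [∀ i, TopologicalSpace (A i)]
    [∀ i, MeasurableSpace (A i)] [∀ i, BorelSpace (A i)] : BorelSpace (Σ i, A i) := by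
  refine ⟨le_antisymm (fun s hs => ?_) (MeasurableSpace.generateFrom_le fun s hs => ?_)⟩
  · have hi : ∀ i, MeasurableSet (Sigma.mk i ⁻¹' s) := fun i =>
      measurable_sigma_iff.1 measurable_id i hs
    have hs' : s = ⋃ i, Sigma.mk i '' (Sigma.mk i ⁻¹' s) := by
      ext ⟨i, x⟩
      simp only [Set.mem_iUnion, Set.mem_image, Set.mem_preimage]
      constructor
      · intro h
        exact ⟨i, x, h, rfl⟩
      · rintro ⟨j, y, h, hy⟩
        rwa [← hy]
    rw [hs']
    let : MeasurableSpace (Σ i, A i) := borel _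
    have : BorelSpace (Σ i, A i) := ⟨rfl⟩
    refine MeasurableSet.iUnion fun i => ?_
    exact (Topology.IsOpenEmbedding.sigmaMk.measurableEmbedding).measurableSet_image.2 (hi i)
  · refine MeasurableSpace.measurableSet_iInf.2 fun i => ?_
    exact ((show IsOpen s from hs).preimage continuous_sigmaMk).measurableSet

instance {ι : Type*} [Countable ι] {A : ι → Type*} [∀ i, MeasurableSpace (A i)]
    [∀ i, StandardBorelSpace (A i)] : StandardBorelSpace (Σ i, A i) := by
  let := fun i => upgradeStandardBorel (A i)
  have : BorelSpace (Σ i, A i) := borelSpace_sigma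
  infer_instance

theorem _root_.MeasurableEquiv.standardBorelSpace {α β : Type*} [MeasurableSpace α]
    [MeasurableSpace β] [StandardBorelSpace β] (e : α ≃ᵐ β) : StandardBorelSpace α := by
  let := upgradeStandardBorel β
  let : TopologicalSpace α := TopologicalSpace.induced e inferInstance
  have : PolishSpace α := e.toEquiv.polishSpace_induced
  have : BorelSpace α := by
    constructor
    rw [borel_comap, ← BorelSpace.measurable_eq (α := β)]
    exact e.measurableEmbedding.comap_eq.symm
  infer_instance

instance {α : Type*} [MeasurableSpace α] [StandardBorelSpace α] : StandardBorelSpace (List α) :=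
  listMeasurableEquiv.standardBorelSpace

end StandardBorel

/-! ### Projective limits of sequences of standard Borel spaces -/

section ProjectiveLimit

variable {Ω : ℕ → Type*} [∀ n, MeasurableSpace (Ω n)] [∀ n, StandardBorelSpace (Ω n)]
  [∀ n, Nonempty (Ω n)]

/-- A projective sequence of probability measures on standard Borel spaces is induced by a
probability measure on compatible sequences. -/
theorem exists_measure_compatible (f : ∀ n, Ω (n + 1) → Ω n) (hf : ∀ n, Measurable (f n))
    (P : ∀ n, Measure (Ω n)) [∀ n, IsProbabilityMeasure (P n)]
    (hP : ∀ n, (P (n + 1)).map (f n) = P n) :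
    ∃ μ : Measure (∀ n, Ω n), IsProbabilityMeasure μ ∧ (∀ n, μ.map (fun ω => ω n) = P n) ∧
      ∀ᵐ ω ∂μ, ∀ n, f n (ω (n + 1)) = ω n := by
  -- A Markov chain: the next coordinate is drawn from its conditional law under `P (n + 1)`, given
  -- that `f n` maps it to the current one; earlier coordinates are ignored.
  let κ : ∀ n, Kernel (Π i : Finset.Iic n, Ω i) (Ω (n + 1)) := fun n =>
    (condDistrib id (f n) (P (n + 1))).comap (fun x => x ⟨n, by simp⟩) (by fun_prop)
  have hκ : ∀ n, IsMarkovKernel (κ n) := fun n => by dsimp only [κ]; infer_instance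
  let μ := Kernel.trajMeasure (P 0) κ
  -- By disintegration, consecutive coordinates are jointly distributed on the graph of `f n`. This
  -- gives both the next marginal and almost sure compatibility.
  have hstep : ∀ n, μ.map (fun ω => ω n) = P n →
      μ.map (fun ω => (ω n, ω (n + 1))) = (P (n + 1)).map fun x => (f n x, x) := by
    intro n hn
    have h := Kernel.map_frestrictLe_trajMeasure_compProd_eq_map_trajMeasure (μ₀ := P 0) (κ := κ)
      (a := n)
    have h2 := congrArg (Measure.map (Prod.map (fun x : Π i : Finset.Iic n, Ω i => x ⟨n, by simp⟩)
      (id : Ω (n + 1) → Ω (n + 1)))) h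
    rw [Measure.map_map (by fun_prop) (by fun_prop)] at h2
    refine h2.symm.trans ?_
    have h3 := compProd_map_condDistrib (mβ := inferInstance) (μ := P (n + 1)) (X := f n) (Y := id) aemeasurable_id
    rw [hP n, ← hn] at h3
    refine Eq.trans ?_ h3
    have hE : Measurable (Prod.map (fun x : Π i : Finset.Iic n, Ω i => x ⟨n, by simp⟩)
      (id : Ω (n + 1) → Ω (n + 1))) := by fun_prop
    refine Measure.ext_of_lintegral _ fun F hF => ?_
    have hFE : Measurable fun a => F (Prod.map (fun x : Π i : Finset.Iic n, Ω i => x ⟨n, by simp⟩)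
      (id : Ω (n + 1) → Ω (n + 1)) a) := hF.comp hE
    rw [lintegral_map hF hE, Measure.lintegral_compProd hFE, Measure.lintegral_compProd hF,
      lintegral_map hFE.lintegral_kernel_prod_right' (by fun_prop),
      lintegral_map hF.lintegral_kernel_prod_right' (by fun_prop)]
    rfl
  have hmarg : ∀ n, μ.map (fun ω => ω n) = P n := by
    intro n
    induction n with
    | zero =>
      have h : μ.map (Preorder.frestrictLe 0) =
          (P 0).map (MeasurableEquiv.piUnique fun i : Finset.Iic 0 => Ω i).symm := by
        change Measure.map _ (Kernel.trajMeasure (P 0) κ) = _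
        rw [Kernel.trajMeasure, Measure.map_comp _ _ (by fun_prop), Kernel.traj_map_frestrictLe,
          Kernel.partialTraj_self, Measure.id_comp]
        rfl
      have h2 := congrArg (Measure.map fun x : Π i : Finset.Iic 0, Ω i => x ⟨0, by simp⟩) h
      rw [Measure.map_map (by fun_prop) (by fun_prop)] at h2
      exact h2.trans ((Measure.map_map (by fun_prop) (MeasurableEquiv.measurable _)).trans
        Measure.map_id)
    | succ n ih =>
      have := congrArg (Measure.map Prod.snd) (hstep n ih)
      rw [Measure.map_map measurable_snd (by fun_prop)] at this
      exact this.trans ((Measure.map_map measurable_snd ((hf n).prodMk measurable_id)).trans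
        Measure.map_id)
  refine ⟨μ, inferInstance, hmarg, ae_all_iff.2 fun n => ?_⟩
  have hS : MeasurableSet {x : Ω n × Ω (n + 1) | f n x.2 = x.1} :=
    measurableSet_eq_fun ((hf n).comp measurable_snd) measurable_fst
  have h := hstep n (hmarg n)
  have : ∀ᵐ x ∂(P (n + 1)).map (fun x => (f n x, x)), f n x.2 = x.1 :=
    (ae_map_iff ((hf n).prodMk measurable_id).aemeasurable hS).2 (ae_of_all _ fun _ => rfl)
  rw [← h] at this
  exact ae_of_ae_map (by fun_prop) this

end ProjectiveLimit

/-! ### The random partition of the infinite array -/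

section Limit

variable {D : ℕ}

/-- The cubes with lower corner at the origin, which are cofinal among the sub-arrays. -/
def cube (D n : ℕ) : SubArray D := ⟨fun _ => 0, fun _ => n + 1, fun _ => n.succ_pos⟩

theorem cube_mono {m n : ℕ} (h : m ≤ n) : cube D m ≤ cube D n := fun _ =>
  Finset.Ico_subset_Ico le_rfl (by simp [cube, h])

/-- The index of a cube which contains the sub-array `X`. -/
def SubArray.cubeIndex (X : SubArray D) : ℕ := ∑ d, (X.lo d + X.len d)

theorem le_cube (X : SubArray D) {n : ℕ} (h : X.cubeIndex ≤ n) : X ≤ cube D n := fun d =>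
  Finset.Ico_subset_Ico (Nat.zero_le _) (by
    have : X.lo d + X.len d ≤ X.cubeIndex :=
      Finset.single_le_sum (f := fun d => X.lo d + X.len d) (fun _ _ => Nat.zero_le _)
        (Finset.mem_univ d)
    simp only [cube]
    omega)

instance (X : SubArray D) : StandardBorelSpace (Partition X) :=
  inferInstanceAs (StandardBorelSpace (List (ℝ≥0 × Patch X)))

instance (X : SubArray D) : Nonempty (Partition X) := ⟨([] : List (ℝ≥0 × Patch X))⟩

theorem restrict_cube {ω : ∀ n, Partition (cube D n)}
    (hω : ∀ n, (ω (n + 1)).restrict (cube_mono n.le_succ) = ω n) {m n : ℕ} (h : m ≤ n) :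
    (ω n).restrict (cube_mono h) = ω m := by
  induction n, h using Nat.le_induction with
  | base => exact Partition.restrict_self _ _
  | succ n h ih =>
    rw [← ih, ← hω n, Partition.restrict_restrict]

/-- A compatible sequence of partitions of the cubes determines a partition of the infinite
array. -/
def ofCubes (ω : ∀ n, Partition (cube D n))
    (hω : ∀ n, (ω (n + 1)).restrict (cube_mono n.le_succ) = ω n) : LimitPartition D :=
  ⟨fun X => (ω X.cubeIndex).restrict (le_cube X le_rfl), fun X Y h => by
    have hX := le_cube X (le_max_left X.cubeIndex Y.cubeIndex)
    beta_reduce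
    -- Both values are written as restrictions from one cube containing `X` and `Y`.
    rw [← restrict_cube hω (le_max_left X.cubeIndex Y.cubeIndex),
      ← restrict_cube hω (le_max_right X.cubeIndex Y.cubeIndex),
      Partition.restrict_restrict _ _ (le_cube Y (le_max_right _ _)),
      Partition.restrict_restrict _ _ hX, Partition.restrict_restrict _ _ hX]⟩

theorem measurable_limitRestrict (X : SubArray D) :
    Measurable (LimitPartition.restrict X) :=
  (measurable_pi_apply X).comp measurable_subtype_coe

theorem LimitPartition.restrict_restrict {X Y : SubArray D} (h : X ≤ Y) (ω : LimitPartition D) :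
    (ω.restrict Y).restrict h = ω.restrict X :=
  ω.2 X Y h

instance : Inhabited (LimitPartition D) := ⟨⟨fun _ => ([] : List _), fun _ _ _ => rfl⟩⟩

variable (P : ∀ X : SubArray D, Measure (Partition X)) [∀ X, IsProbabilityMeasure (P X)]

theorem exists_limit_measure
    (hP : ∀ (X Y : SubArray D) (h : X ≤ Y), (P Y).map (Partition.restrict h) = P X) :
    ∃ μ : Measure (LimitPartition D), ∀ X, μ.map (LimitPartition.restrict X) = P X := by
  classical
  obtain ⟨ν, hν, hmarg, hcomp⟩ := exists_measure_compatible (Ω := fun n => Partition (cube D n))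
    (fun n => Partition.restrict (cube_mono n.le_succ)) (fun n => measurable_restrict _)
    (fun n => P (cube D n)) (fun n => hP _ _ _)
  let C : Set (∀ n, Partition (cube D n)) :=
    {ω | ∀ n, (ω (n + 1)).restrict (cube_mono n.le_succ) = ω n}
  have hC : MeasurableSet C := by
    have : C = ⋂ n, {ω | (ω (n + 1)).restrict (cube_mono n.le_succ) = ω n} := by
      ext ω
      simp [C]
    rw [this]
    exact MeasurableSet.iInter fun n => measurableSet_eq_fun
      ((measurable_restrict _).comp (measurable_pi_apply (n + 1))) (measurable_pi_apply n)
  -- Off the almost sure event `C` the value is arbitrary; the family of empty partitions keeps `φ`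
  -- total and measurable.
  let φ : (∀ n, Partition (cube D n)) → LimitPartition D := fun ω =>
    if h : ω ∈ C then ofCubes ω h else default
  have hφ : Measurable φ := by
    refine Measurable.subtype_mk (measurable_pi_iff.2 fun X => ?_)
    have : (fun ω => (φ ω).1 X) = fun ω => if ω ∈ C then
        (ω X.cubeIndex).restrict (le_cube X le_rfl) else (default : LimitPartition D).1 X := by
      funext ω
      by_cases h : ω ∈ C
      · rw [if_pos h, show φ ω = ofCubes ω h from dif_pos h]
        rfl
      · rw [if_neg h, show φ ω = default from dif_neg h]
    exact this ▸ Measurable.ite hC ((measurable_restrict _).comp (measurable_pi_apply _))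
      measurable_const
  refine ⟨ν.map φ, fun X => ?_⟩
  rw [Measure.map_map (measurable_limitRestrict X) hφ, ← hP X _ (le_cube X le_rfl), ← hmarg,
    Measure.map_map (measurable_restrict _) (measurable_pi_apply X.cubeIndex)]
  refine Measure.map_congr ?_
  filter_upwards [hcomp] with ω hω
  have : φ ω = ofCubes ω hω := dif_pos hω
  rw [Function.comp_apply, this]
  rfl

/-- Cylinder sets generate the σ-algebra and are closed under intersection, because any two
sub-arrays lie in a common cube. -/
theorem limit_measure_unique {μ ν : Measure (LimitPartition D)}
    (hμ : ∀ X, μ.map (LimitPartition.restrict X) = P X)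
    (hν : ∀ X, ν.map (LimitPartition.restrict X) = P X) : μ = ν := by
  have happ : ∀ {ρ : Measure (LimitPartition D)}, (∀ X, ρ.map (LimitPartition.restrict X) = P X) →
      ∀ X (s : Set (Partition X)), MeasurableSet s →
        ρ (LimitPartition.restrict X ⁻¹' s) = P X s := by
    intro ρ hρ X s hs
    rw [← hρ X, Measure.map_apply (measurable_limitRestrict X) hs]
  -- Finiteness is not assumed; the total mass can be read off from any one marginal.
  have hfin : IsFiniteMeasure μ := ⟨by
    have := happ hμ (cube D 0) Set.univ .univ
    rw [Set.preimage_univ] at this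
    simp [this]⟩
  refine ext_of_generate_finite
    {t | ∃ X, ∃ s : Set (Partition X), MeasurableSet s ∧ LimitPartition.restrict X ⁻¹' s = t}
    ?_ ?_ ?_ ?_
  · refine le_antisymm ?_ (MeasurableSpace.generateFrom_le ?_)
    · change MeasurableSpace.comap Subtype.val
        (⨆ X, MeasurableSpace.comap (fun ω : ∀ X, Partition X => ω X) inferInstance) ≤ _
      rw [MeasurableSpace.comap_iSup]
      refine iSup_le fun X => ?_
      rw [MeasurableSpace.comap_comp]
      rintro _ ⟨s, hs, rfl⟩
      exact MeasurableSpace.measurableSet_generateFrom ⟨X, s, hs, rfl⟩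
    · rintro _ ⟨X, s, hs, rfl⟩
      exact measurable_limitRestrict X hs
  · rintro _ ⟨X, s, hs, rfl⟩ _ ⟨Y, t, ht, rfl⟩ -
    have hX := le_cube X (le_max_left X.cubeIndex Y.cubeIndex)
    have hY := le_cube Y (le_max_right X.cubeIndex Y.cubeIndex)
    refine ⟨_, Partition.restrict hX ⁻¹' s ∩ Partition.restrict hY ⁻¹' t,
      (measurable_restrict hX hs).inter (measurable_restrict hY ht), ?_⟩
    ext ω
    simp [LimitPartition.restrict_restrict]
  · rintro _ ⟨X, s, hs, rfl⟩
    rw [happ hμ X s hs, happ hν X s hs]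
  · have h1 := happ hμ (cube D 0) Set.univ .univ
    have h2 := happ hν (cube D 0) Set.univ .univ
    rw [Set.preimage_univ] at h1 h2
    rw [h1, h2]

end Limit

end SPP

end

/-! ### The main theorem. -/

theorem mainTheorem1 {D : ℕ} (θ : unitInterval) (τ : ℝ≥0) (hτ : 0 < τ) :
    -- each `SPP(X, τ)` is a probability measure on the partitions of `X`
    (∀ X : SPP.SubArray D, IsProbabilityMeasure (SPP.law θ τ X)) ∧
    -- the spaces of partitions with the restriction maps form a projective system
    (∀ (X : SPP.SubArray D) (h : X ≤ X) (ω : SPP.Partition X), ω.restrict h = ω) ∧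
    (∀ (W X Y : SPP.SubArray D) (hWX : W ≤ X) (hXY : X ≤ Y) (hWY : W ≤ Y) (ω : SPP.Partition Y),
      (ω.restrict hXY).restrict hWX = ω.restrict hWY) ∧
    (∀ (X Y : SPP.SubArray D) (h : X ≤ Y),
      Measurable (SPP.Partition.restrict h : SPP.Partition Y → SPP.Partition X)) ∧
    -- self-consistency: restricting `SPP(Y, τ)` to `X` gives `SPP(X, τ)`
    (∀ (X Y : SPP.SubArray D) (h : X ≤ Y),
      (SPP.law θ τ Y).map (SPP.Partition.restrict h) = SPP.law θ τ X) ∧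
    -- there is exactly one measure on the projective limit with these marginals
    (∃ P : Measure (SPP.LimitPartition D),
      IsProbabilityMeasure P ∧
      (∀ X : SPP.SubArray D, P.map (SPP.LimitPartition.restrict X) = SPP.law θ τ X) ∧
      ∀ Q : Measure (SPP.LimitPartition D),
        (∀ X : SPP.SubArray D, Q.map (SPP.LimitPartition.restrict X) = SPP.law θ τ X) → Q = P) := by
  have hprob := SPP.isProbabilityMeasure_law (D := D) θ τ hτ
  have hmap : ∀ (X Y : SPP.SubArray D) (h : X ≤ Y),
      (SPP.law θ τ Y).map (SPP.Partition.restrict h) = SPP.law θ τ X :=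
    fun _ _ h => SPP.map_restrict_law θ τ hτ h
  obtain ⟨P, hP⟩ := SPP.exists_limit_measure (SPP.law θ τ) hmap
  refine ⟨hprob, fun _ => SPP.Partition.restrict_self, fun _ _ _ => SPP.Partition.restrict_restrict,
    fun _ _ => SPP.measurable_restrict, hmap, P, ⟨?_⟩, hP,
    fun Q hQ => SPP.limit_measure_unique (SPP.law θ τ) hQ hP⟩
  have h := (hprob (SPP.cube D 0)).measure_univ
  rwa [← hP, Measure.map_apply (SPP.measurable_limitRestrict _) .univ] at h
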